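/- Let $k$ be an algebraically closed field of characteristic $p>0$, let $c>0$ be an integer divisible by $p-1$, and in $K^*=k(x,y)$ put $$u=\frac{x^p}{1-x^{p-1}},\qquad v=y^p-x^cy,\qquad K=k(u,v)\subset K_1=k(x,v)\subset K^*.$$ Let $R=k[u,v]_{(u,v)}$ and $A=k[x,v]_{(x,v)}$. Define $Q_0=x$, $Q_1=y$, $Q_2=y^{p^2}-x$, $Q_{j+1}=Q_j^{p^2}-x^{p^{2j-2}}Q_{j-1}$ for $j\ge 2$, and $\overline\beta_0=1$, $\overline\beta_1=p^{-2}$, $\overline\beta_j=p^{-2}(p^{2j-2}+\overline\beta_{j-1})$ for $j\ge 2$. There is a $k$-valuation $\nu^*$ of $K^*$ with $\nu^*(Q_j)=\overline\beta_j$ for all $j\ge 0$; let $\nu_1=\nu^*|K_1$ and $\nu=\nu^*|K$. Define $$P_0=u,\quad P_1=v,\quad P_2=v^{p^2}-u,\quad P_{j+1}=P_j^{p^2}-u^{p^{2j-2}}P_{j-1}\ (j\ge 2),$$ $$U_0=x,\quad U_1=v,\quad U_2=v^p-x,\quad U_{j+1}=\begin{cases}U_j^p-x^{p^{2j-2}}U_{j-1}&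 j\ge 2 \text{ odd}\\ U_j^{p^3}-x^{p^{2j-1}}U_{j-1}& j\ge 2\text{ even,}\end{cases}$$ and put $u_{R_1}=u$, $v_{R_1}=v$, $v_{R_2}=P_2/u$, $x_{A_1}=x$, $v_{A_1}=v$, $v_{A_2}=U_2/x$; $u_{R_{j+1}}=v_{R_j}$ and $x_{A_{j+1}}=v_{A_j}$ for $j\ge 1$; and, for $j\ge 2$, $$v_{R_{j+1}}=\frac{P_{j+1}}{u^{p^{2j-2}}P_{j-1}},\qquad v_{A_{j+1}}=\frac{U_{j+1}}{x^{p^{2j-2}}U_{j-1}}\ (j\text{ odd}),\qquad v_{A_{j+1}}=\frac{U_{j+1}}{x^{p^{2j-1}}U_{j-1}}\ (j\text{ even}).$$ For any such $\nu^*$ there are sequences $R=R_1\to R_2\to\cdots$ and $A=A_1\to A_2\to\cdots$ of two-dimensional regular local rings such that each $R_j\to R_{j+1}$ is a finite sequence of quadratic transforms along $\nu$, each $A_j\to A_{j+1}$ is a finite sequence of quadratic transforms along $\nu_1$, and $u_{R_j},v_{R_j}$ and $x_{A_j},v_{A_j}$ are regular parameters in $R_j$ and $A_j$ respectively, for all $j\ge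 1$. **Theorem.** Such a $\nu^*$ and such sequences exist, and for any such $\nu^*$ and sequences the following holds. (1) For all $j\ge 1$, $A_j$ dominates $R_j$ and is a finite extension of it, and no quadratic transform of $R_j$ is contained in $A_j$. (2) For every odd $j\ge 1$ there are units $\sigma_{j+1},\lambda_{j+1}$ in $A_{j+1}$ and $\Lambda_{j+1}\in A_{j+1}$ with $$u_{R_{j+1}}=\sigma_{j+1}x_{A_{j+1}},\qquad v_{R_{j+1}}=\lambda_{j+1}v_{A_{j+1}}^p+x_{A_{j+1}}\Lambda_{j+1}.$$ For every even $j\ge 2$ there are units $\sigma_{j+1},\lambda_{j+1}$ in $A_{j+1}$ and $\Lambda_{j+1}\in A_{j+1}$ with $$u_{R_{j+1}}=\sigma_{j+1}x_{A_{j+1}}^p,\qquad v_{R_{j+1}}=\lambda_{j+1}v_{A_{j+1}}+x_{A_{j+1}}\Lambda_{j+1}.$$ (3) For every $j\ge 1$ there are unique integers $\alpha_j,\beta_j\ge 0$ for which there is a stable form $u_{R_j}=\gamma_jx_{A_j}^{p^{\alpha_j}}$, $v_{R_j}=x_{A_j}^{b_j}f_j$, with $\gamma_j$ a unit in $A_j$,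 $b_j\ge 0$, $f_j\in A_j$, $A_j/x_{A_j}A_j$ a discrete valuation ring, and the class of $f_j$ in it of order $p^{\beta_j}$. They are $\alpha_j=1$, $\beta_j=0$ if $j$ is odd, and $\alpha_j=0$, $\beta_j=1$ if $j$ is even. -/

import Mathlib

open IsLocalRing

noncomputable section

/-! ### Local rings in a field, and quadratic transforms -/

section LocalRings

variable {L : Type*} [Field L]

/-- The subring of a field `L ⊇ k` consisting of all quotients `f(a,b) / g(a,b)` with `f, g`
polynomials over `k` and `g(0,0) ≠ 0`, `g(a,b) ≠ 0`. -/
def originSubring (k : Type*) [Field k] [Algebra k L] (a b : L) : Subring L where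
  carrier := {z | ∃ f g : MvPolynomial (Fin 2) k, MvPolynomial.constantCoeff g ≠ 0 ∧
    MvPolynomial.aeval ![a, b] g ≠ 0 ∧
    z = MvPolynomial.aeval ![a, b] f / MvPolynomial.aeval ![a, b] g}
  mul_mem' := by
    rintro _ _ ⟨f, g, h0, h1, rfl⟩ ⟨f', g', h0', h1', rfl⟩
    refine ⟨f * f', g * g', by simp [h0, h0'], by simp [h1, h1'], ?_⟩
    rw [map_mul, map_mul, div_mul_div_comm]
  one_mem' := ⟨1, 1, by simp, by simp, by simp⟩
  add_mem' := by
    rintro _ _ ⟨f, g, h0, h1, rfl⟩ ⟨f', g', h0', h1', rfl⟩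
    refine ⟨f * g' + g * f', g * g', by simp [h0, h0'], by simp [h1, h1'], ?_⟩
    rw [map_mul, map_add, map_mul, map_mul, div_add_div _ _ h1 h1']
  zero_mem' := ⟨0, 1, by simp, by simp, by simp⟩
  neg_mem' := by
    rintro _ ⟨f, g, h0, h1, rfl⟩
    exact ⟨-f, g, h0, h1, by rw [map_neg, neg_div]⟩

theorem originSubring_isLocalRing (k : Type*) [Field k] [Algebra k L] (a b : L) :
    IsLocalRing (originSubring k a b) := by
  refine IsLocalRing.of_isUnit_or_isUnit_one_sub_self ?_
  rintro ⟨z, f, g, h0, h1, hz⟩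
  by_cases hf : MvPolynomial.constantCoeff f = 0
  · by_cases h2 : MvPolynomial.aeval ![a, b] (g - f) = 0
    · left
      have : z = 1 := by
        rw [hz, div_eq_one_iff_eq h1]
        rw [map_sub, sub_eq_zero] at h2
        exact h2.symm
      have h3 : (⟨z, f, g, h0, h1, hz⟩ : originSubring k a b) = 1 := Subtype.ext this
      rw [h3]
      exact isUnit_one
    · right
      refine IsUnit.of_mul_eq_one ⟨MvPolynomial.aeval ![a, b] g / MvPolynomial.aeval ![a, b] (g - f),
        g, g - f, by simp [hf, h0], h2, rfl⟩ (Subtype.ext ?_)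
      change (1 - z) * (MvPolynomial.aeval ![a, b] g / MvPolynomial.aeval ![a, b] (g - f)) = 1
      rw [map_sub] at h2 ⊢
      rw [hz]
      field_simp
  · by_cases h2 : MvPolynomial.aeval ![a, b] f = 0
    · right
      have : z = 0 := by rw [hz, h2, zero_div]
      have h3 : (⟨z, f, g, h0, h1, hz⟩ : originSubring k a b) = 0 := Subtype.ext this
      rw [h3, sub_zero]
      exact isUnit_one
    · left
      refine IsUnit.of_mul_eq_one ⟨MvPolynomial.aeval ![a, b] g / MvPolynomial.aeval ![a, b] f,
        g, f, hf, h2, rfl⟩ (Subtype.ext ?_)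
      change z * (MvPolynomial.aeval ![a, b] g / MvPolynomial.aeval ![a, b] f) = 1
      rw [hz]
      field_simp

/-- For `a, b` algebraically independent over `k`, this is the local ring `k[a,b]_{(a,b)}`. -/
def originLocalRing (k : Type*) [Field k] [Algebra k L] (a b : L) : LocalSubring L :=
  @LocalSubring.mk L _ (originSubring k a b) (originSubring_isLocalRing k a b)

/-- `B` is a regular local ring of dimension two with regular system of parameters `s, t`. -/
def IsRegularParameters (B : LocalSubring L) (s t : L) : Prop :=
  IsRegularLocalRing B.toSubring ∧ ringKrullDim B.toSubring = 2 ∧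
    ∃ s' t' : B.toSubring, (s' : L) = s ∧ (t' : L) = t ∧
      maximalIdeal B.toSubring = Ideal.span {s', t'}

/-- The ring `B[m_B / s]`. -/
def blowupChart (B : LocalSubring L) (s : L) : Subring L :=
  Subring.closure ((B.toSubring : Set L) ∪ {w | ∃ z ∈ maximalIdeal B.toSubring, w = (z : L) / s})

theorem le_blowupChart (B : LocalSubring L) (s : L) : B.toSubring ≤ blowupChart B s :=
  fun _ hz => Subring.subset_closure (Or.inl hz)

/-- `B'` is a quadratic transform of `B`: it is the localization of `B[m_B / s]`, with
`0 ≠ s ∈ m_B`, at a prime ideal lying over `m_B`. -/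
def IsQuadraticTransform (B B' : LocalSubring L) : Prop :=
  ∃ s ∈ maximalIdeal B.toSubring, s ≠ 0 ∧
    ∃ (P : Ideal (blowupChart B (s : L))) (_ : P.IsPrime),
      P.comap (Subring.inclusion (le_blowupChart B (s : L))) = maximalIdeal B.toSubring ∧
      B' = LocalSubring.ofPrime (blowupChart B (s : L)) P

/-- The valuation `ν` dominates the local ring `B`: `B ⊆ V_ν` and `m_ν ∩ B = m_B`. -/
def ValuationDominates (ν : AddValuation L (WithTop ℚ)) (B : LocalSubring L) : Prop :=
  ∀ b : B.toSubring, 0 ≤ ν (b : L) ∧ (b ∈ maximalIdeal B.toSubring ↔ 0 < ν (b : L))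

/-- `B'` is a quadratic transform of `B` along `ν`. If `B` lies in a subfield `F` of `L`, so does
`B'`, and this says the same as being a quadratic transform along the restriction of `ν` to `F`. -/
def IsQuadraticTransformAlong (ν : AddValuation L (WithTop ℚ)) (B B' : LocalSubring L) : Prop :=
  IsQuadraticTransform B B' ∧ ValuationDominates ν B'

/-- `B 1 = B₁`, each `B (j + 1)` is obtained from `B j` by a finite sequence of quadratic transforms
along `ν`, and `s j, t j` are regular parameters in `B j`, for all `j ≥ 1`.
This determines `B j` for all `j ≥ 1`: two different members of a sequence of quadratic transforms
do not have a common system of regular parameters. -/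
structure IsTransformSequence (ν : AddValuation L (WithTop ℚ)) (B₁ : LocalSubring L)
    (s t : ℕ → L) (B : ℕ → LocalSubring L) : Prop where
  first : B 1 = B₁
  step : ∀ j, 1 ≤ j → Relation.ReflTransGen (IsQuadraticTransformAlong ν) (B j) (B (j + 1))
  parameters : ∀ j, 1 ≤ j → IsRegularParameters (B j) (s j) (t j)

/-- In the local ring `S`, with parameters `u, v` of a smaller ring and `x` in `S`, one has
`u = γ x^(a p^α)` and `v = x^b f` with a unit `γ`, where `S / xS` is a discrete valuation
ring in which the class of `f` has order `p^β`. -/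
def IsStableForm (p a : ℕ) (S : LocalSubring L) (u v x : L) (α β : ℕ) : Prop :=
  ∃ (γ f x' : S.toSubring) (b : ℕ), (x' : L) = x ∧ IsUnit γ ∧
    u = (γ : L) * x ^ (a * p ^ α) ∧ v = x ^ b * (f : L) ∧
    ∃ (_ : IsDomain (S.toSubring ⧸ Ideal.span {x'}))
      (_ : IsDiscreteValuationRing (S.toSubring ⧸ Ideal.span {x'})),
      IsDiscreteValuationRing.addVal (S.toSubring ⧸ Ideal.span {x'})
        (Ideal.Quotient.mk (Ideal.span {x'}) f) = ((p ^ β : ℕ) : ℕ∞)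

end LocalRings

/-! ### The generating sequences and the regular parameters of the example -/

section Sequences

variable {L : Type*} [Field L]

/-- The sequence `Q₀ = x`, `Q₁ = y`, `Q₂ = y^(p²) - x`,
`Q_{j+1} = Q_j^(p²) - x^(p^(2j-2)) Q_{j-1}` for `j ≥ 2` (here `j = n + 2`).
With `u, v` in place of `x, y` it is the sequence `P_j`. -/
def genSeq (p : ℕ) (x y : L) : ℕ → L
  | 0 => x
  | 1 => y
  | 2 => y ^ p ^ 2 - x
  | n + 3 => genSeq p x y (n + 2) ^ p ^ 2 - x ^ p ^ (2 * n + 2) * genSeq p x y (n + 1)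

/-- The sequence `U₀ = x`, `U₁ = v`, `U₂ = v^p - x` and, for `j ≥ 2` (here `j = n + 2`),
`U_{j+1} = U_j^p - x^(p^(2j-2)) U_{j-1}` if `j` is odd and
`U_{j+1} = U_j^(p³) - x^(p^(2j-1)) U_{j-1}` if `j` is even. -/
def genSeqU (p : ℕ) (x v : L) : ℕ → L
  | 0 => x
  | 1 => v
  | 2 => v ^ p - x
  | n + 3 =>
    if Odd (n + 2) then
      genSeqU p x v (n + 2) ^ p - x ^ p ^ (2 * n + 2) * genSeqU p x v (n + 1)
    else
      genSeqU p x v (n + 2) ^ p ^ 3 - x ^ p ^ (2 * n + 3) * genSeqU p x v (n + 1)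

/-- The values of the `Q_j`: `1, 1/p²`, and `(p^(2j-2) + β_{j-1}) / p²` for `j ≥ 2`
(here `j = n + 2`). -/
def betaBar (p : ℕ) : ℕ → ℚ
  | 0 => 1
  | 1 => 1 / (p : ℚ) ^ 2
  | n + 2 => ((p : ℚ) ^ (2 * n + 2) + betaBar p (n + 1)) / (p : ℚ) ^ 2

/-- `v_{R_1} = v`, `v_{R_2} = P_2 / u`, `v_{R_{k+1}} = P_{k+1} / (u^(p^(2k-2)) P_{k-1})` for
`k ≥ 2` (here `k = n + 2`). The value at `0` is `u`. -/
def paramVR (p : ℕ) (u v : L) : ℕ → L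
  | 0 => u
  | 1 => v
  | 2 => genSeq p u v 2 / u
  | n + 3 => genSeq p u v (n + 3) / (u ^ p ^ (2 * n + 2) * genSeq p u v (n + 1))

/-- `u_{R_1} = u`, and `u_{R_{j+1}} = v_{R_j}` for `j ≥ 1`. -/
def paramUR (p : ℕ) (u v : L) (j : ℕ) : L := paramVR p u v (j - 1)

/-- `v_{A_1} = v`, `v_{A_2} = U_2 / x` and, for `j ≥ 2` (here `j = n + 2`),
`v_{A_{j+1}} = U_{j+1} / (x^(p^(2j-2)) U_{j-1})` if `j` is odd and
`v_{A_{j+1}} = U_{j+1} / (x^(p^(2j-1)) U_{j-1})` if `j` is even. The value at `0` is `x`. -/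
def paramVA (p : ℕ) (x v : L) : ℕ → L
  | 0 => x
  | 1 => v
  | 2 => genSeqU p x v 2 / x
  | n + 3 =>
    if Odd (n + 2) then
      genSeqU p x v (n + 3) / (x ^ p ^ (2 * n + 2) * genSeqU p x v (n + 1))
    else
      genSeqU p x v (n + 3) / (x ^ p ^ (2 * n + 3) * genSeqU p x v (n + 1))

/-- `x_{A_1} = x`, and `x_{A_{j+1}} = v_{A_j}` for `j ≥ 1`. -/
def paramXA (p : ℕ) (x v : L) (j : ℕ) : L := paramVA p x v (j - 1)

end Sequences

/-! ### The function field and its valuation -/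

/-- The rational function field `k(x, y)`. -/
abbrev FunctionField₂ (k : Type*) [Field k] : Type _ := FractionRing (MvPolynomial (Fin 2) k)

/-- The element `x` of `k(x, y)`. -/
def xElt (k : Type*) [Field k] : FunctionField₂ k :=
  algebraMap (MvPolynomial (Fin 2) k) _ (MvPolynomial.X 0)

/-- The element `y` of `k(x, y)`. -/
def yElt (k : Type*) [Field k] : FunctionField₂ k :=
  algebraMap (MvPolynomial (Fin 2) k) _ (MvPolynomial.X 1)

/-- `u = x^p / (1 - x^(p-1))`. -/
def uElt (p : ℕ) (k : Type*) [Field k] : FunctionField₂ k :=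
  xElt k ^ p / (1 - xElt k ^ (p - 1))

/-- `v = y^p - x^c y`. -/
def vElt (p c : ℕ) (k : Type*) [Field k] : FunctionField₂ k :=
  yElt k ^ p - xElt k ^ c * yElt k

/-- `ν` is the `k`-valuation `ν*` of `k(x, y)` determined by the generating sequence `Q_j` of
`k[x,y]_{(x,y)}`, with its values, normalized by `ν(x) = 1`. -/
structure IsNuStar (p : ℕ) (k : Type*) [Field k]
    (ν : AddValuation (FunctionField₂ k) (WithTop ℚ)) : Prop where
  trivial_on : ∀ a : k, a ≠ 0 → ν (algebraMap k (FunctionField₂ k) a) = 0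
  value : ∀ j, ν (genSeq p (xElt k) (yElt k) j) = ((betaBar p j : ℚ) : WithTop ℚ)

/-- The sequence `A_1 = k[x,v]_{(x,v)}, A_2, A_3, …`. -/
def IsSequenceA (p c : ℕ) (k : Type*) [Field k] (ν : AddValuation (FunctionField₂ k) (WithTop ℚ))
    (A : ℕ → LocalSubring (FunctionField₂ k)) : Prop :=
  IsTransformSequence ν (originLocalRing k (xElt k) (vElt p c k))
    (paramXA p (xElt k) (vElt p c k)) (paramVA p (xElt k) (vElt p c k)) A

/-- The sequence `R_1 = k[u,v]_{(u,v)}, R_2, R_3, …`. -/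
def IsSequenceR (p c : ℕ) (k : Type*) [Field k] (ν : AddValuation (FunctionField₂ k) (WithTop ℚ))
    (R : ℕ → LocalSubring (FunctionField₂ k)) : Prop :=
  IsTransformSequence ν (originLocalRing k (uElt p k) (vElt p c k))
    (paramUR p (uElt p k) (vElt p c k)) (paramVR p (uElt p k) (vElt p c k)) R

end

/-!
All the local rings in question are of the form `k[a, b]_{(a, b)}`, with consecutive members `a, b`
of a sequence of parameters `t`. For each of the three sequences (built from the `Q_j`, the `U_j`
and the `P_j`) the recursion, divided by the monomial that it subtracts, becomes a relation
`(1 + t (n + 2)) * t n = ε * t (n + 1) ^ e n` with `ε = 1` for `n ≤ 1` and `ε = 1 + t n` otherwise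
(`IsParameterChain`, `isParameterChain_of_recursion`). So `t n` is a unit times `t (n + 1) ^ e n` in
the next ring, and `e n` quadratic transforms lead from one ring to the next
(`IsParameterChain.reflTransGen_succ`).

Two chains `s`, `t` of this kind are compared by `IsPowerForm`: `s n = σ * t n ^ a` and
`s (n + 1) = lam * t (n + 1) ^ b + t n * Λ`, with `σ` and `lam` congruent to `1` modulo the maximal
ideal. Because the exponents are powers of the characteristic, such a form is passed on to the next
pair of rings with `a` and `b` exchanged (`IsPowerForm.succ`). This holds for the chain of the `U_j`
inside that of the `Q_j` and for the chain of the `P_j` inside that of the `U_j`; the latter gives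
the expressions for the parameters of `R_j` in `A_j`, domination, and the invariants of stable forms
(`IsPowerForm.isStableForm_iff`). Some power of the maximal ideal of `A_j` lies in the ideal
generated by that of `R_j`. This ideal would be principal if `A_j` contained a quadratic transform
of `R_j`, which is impossible in a two-dimensional ring
(`IsPowerForm.not_le_of_isQuadraticTransform`).

Finiteness of `A_j` over `R_j` also goes up the chain (`IsFiniteOver.succ`). New elements are
integral by the relation in the other chain, and `A_{j+1}` is generated over `R_{j+1}` by finitely
many integral elements, without localizing, because the finite extension that they generate is
already local: each of its elements has a `p`-power power that is congruent to an element of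
`R_{j+1}` modulo the maximal ideal of `R_{j+1}` (`isFiniteOver_of_frobeniusConstant`).

The valuation exists since the union of the rings of the chain of the `Q_j` is dominated by a
valuation ring. The values of the parameters are forced, and expanding polynomials in powers of the
`Q_j` shows that the value of a nonzero polynomial is one of those generated by them, because terms
with different exponents have different values (`exists_eq_pow_of_natDegree_lt`,
`exists_isNuStar`). Any `ν` with the required values dominates all the rings. The rings of the
sequences are unique, since a ring dominated by `ν` has only one quadratic transform along `ν` and
two rings of a sequence of quadratic transforms do not share regular parameters
(`IsTransformSequence.unique`).
-/

/-! ### The maximal ideal of a local subring as a subset of the field -/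

section LocalSubrings

variable {L : Type*} [Field L]

namespace LocalSubring

/-- The element `z` of the field lies in the maximal ideal of the local subring `B`. -/
def MemMax (B : LocalSubring L) (z : L) : Prop :=
  ∃ h : z ∈ B.toSubring, (⟨z, h⟩ : B.toSubring) ∈ maximalIdeal B.toSubring

variable {B B' : LocalSubring L} {z w : L}

theorem MemMax.mem (h : B.MemMax z) : z ∈ B.toSubring := h.1

theorem memMax_coe {z : B.toSubring} : B.MemMax (z : L) ↔ z ∈ maximalIdeal B.toSubring :=
  ⟨fun h => h.2, fun h => ⟨z.2, h⟩⟩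

theorem memMax_zero : B.MemMax 0 := ⟨zero_mem _, (maximalIdeal B.toSubring).zero_mem⟩

theorem MemMax.add (hz : B.MemMax z) (hw : B.MemMax w) : B.MemMax (z + w) :=
  ⟨add_mem hz.1 hw.1, (maximalIdeal B.toSubring).add_mem hz.2 hw.2⟩

theorem MemMax.sub (hz : B.MemMax z) (hw : B.MemMax w) : B.MemMax (z - w) :=
  ⟨sub_mem hz.1 hw.1, (maximalIdeal B.toSubring).sub_mem hz.2 hw.2⟩

theorem MemMax.mul_left (hw : w ∈ B.toSubring) (hz : B.MemMax z) : B.MemMax (w * z) :=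
  ⟨mul_mem hw hz.1, (maximalIdeal B.toSubring).mul_mem_left ⟨w, hw⟩ hz.2⟩

theorem MemMax.mul_right (hz : B.MemMax z) (hw : w ∈ B.toSubring) : B.MemMax (z * w) :=
  mul_comm w z ▸ hz.mul_left hw

theorem MemMax.pow (hz : B.MemMax z) {n : ℕ} (hn : n ≠ 0) : B.MemMax (z ^ n) := by
  obtain ⟨m, rfl⟩ := Nat.exists_eq_succ_of_ne_zero hn
  rw [pow_succ]
  exact hz.mul_left (pow_mem hz.1 m)

theorem not_memMax_one : ¬ B.MemMax (1 : L) := fun h =>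
  (Ideal.ne_top_iff_one _).1 (maximalIdeal.isMaximal B.toSubring).ne_top h.2

theorem inv_mem_of_not_memMax (hz : z ∈ B.toSubring) (h : ¬ B.MemMax z) :
    z ≠ 0 ∧ z⁻¹ ∈ B.toSubring := by
  have hu : IsUnit (⟨z, hz⟩ : B.toSubring) := by
    by_contra hu
    exact h ⟨hz, (mem_maximalIdeal _).2 hu⟩
  obtain ⟨y, hy⟩ := hu.exists_right_inv
  have hy' : z * (y : L) = 1 := congrArg Subtype.val hy
  refine ⟨left_ne_zero_of_mul_eq_one hy', ?_⟩
  rw [inv_eq_of_mul_eq_one_right hy']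
  exact y.2

theorem not_memMax_of_inv_mem (h0 : z ≠ 0) (h : z⁻¹ ∈ B.toSubring) : ¬ B.MemMax z := fun hz => by
  have := hz.mul_left h
  rw [inv_mul_cancel₀ h0] at this
  exact not_memMax_one this

theorem isUnit_iff_not_memMax {z : B.toSubring} : IsUnit z ↔ ¬ B.MemMax (z : L) := by
  rw [memMax_coe, mem_maximalIdeal, mem_nonunits_iff, not_not]

theorem not_memMax_one_add (hz : B.MemMax z) : ¬ B.MemMax (1 + z) := fun h =>
  not_memMax_one (by simpa using h.sub hz)

theorem memMax_iff_of_le (h : B ≤ B') (hz : z ∈ B.toSubring) : B.MemMax z ↔ B'.MemMax z := by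
  constructor
  · intro hm
    by_contra hc
    obtain ⟨h1, h2⟩ := h
    have hu : IsUnit (Subring.inclusion h1 ⟨z, hz⟩) := isUnit_iff_not_memMax.2 hc
    exact isUnit_iff_not_memMax.1 (h2.map_nonunit _ hu) hm
  · intro hm
    by_contra hc
    obtain ⟨h0, hi⟩ := inv_mem_of_not_memMax hz hc
    exact not_memMax_of_inv_mem h0 (h.1 hi) hm

theorem MemMax.of_le (h : B ≤ B') (hz : B.MemMax z) : B'.MemMax z :=
  (memMax_iff_of_le h hz.1).1 hz

theorem le_of_memMax (h : B.toSubring ≤ B'.toSubring) (h' : ∀ z, B.MemMax z → B'.MemMax z) :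
    B ≤ B' := by
  refine ⟨h, ⟨fun a ha => ?_⟩⟩
  rw [isUnit_iff_not_memMax] at ha ⊢
  exact fun hc => ha (h' _ hc)

end LocalSubring

end LocalSubrings

/-! ### The local ring of the plane at the origin -/

section Origin

open LocalSubring

variable {L : Type*} [Field L] {k : Type*} [Field k] [Algebra k L]

theorem MvPolynomial.exists_eq_C_add_X_mul (f : MvPolynomial (Fin 2) k) :
    ∃ g h, f = C (constantCoeff f) + X 0 * g + X 1 * h := by
  induction f using MvPolynomial.induction_on with
  | C a => exact ⟨0, 0, by simp⟩
  | add f f' hf hf' =>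
    obtain ⟨g, h, e⟩ := hf
    obtain ⟨g', h', e'⟩ := hf'
    refine ⟨g + g', h + h', ?_⟩
    rw [map_add, map_add]
    linear_combination e + e'
  | mul_X f i _ =>
    fin_cases i
    · exact ⟨f, 0, by simp [mul_comm]⟩
    · exact ⟨0, f, by simp [mul_comm]⟩

variable {a b : L}

theorem algebraMap_mem_origin (a b : L) (c : k) :
    algebraMap k L c ∈ (originLocalRing k a b).toSubring :=
  ⟨MvPolynomial.C c, 1, by simp, by simp, by simp⟩

theorem aeval_mem_origin (a b : L) (f : MvPolynomial (Fin 2) k) :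
    MvPolynomial.aeval ![a, b] f ∈ (originLocalRing k a b).toSubring :=
  ⟨f, 1, by simp, by simp, by simp⟩

theorem left_mem_origin (k : Type*) [Field k] [Algebra k L] (a b : L) :
    a ∈ (originLocalRing k a b).toSubring := by
  simpa using aeval_mem_origin (k := k) a b (MvPolynomial.X 0)

theorem right_mem_origin (k : Type*) [Field k] [Algebra k L] (a b : L) :
    b ∈ (originLocalRing k a b).toSubring := by
  simpa using aeval_mem_origin (k := k) a b (MvPolynomial.X 1)

theorem MvPolynomial.aeval_mem_of_mem {S : Subring L} (hk : ∀ c : k, algebraMap k L c ∈ S)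
    (ha : a ∈ S) (hb : b ∈ S) (f : MvPolynomial (Fin 2) k) : MvPolynomial.aeval ![a, b] f ∈ S := by
  induction f using MvPolynomial.induction_on with
  | C c => simpa using hk c
  | add f g hf hg => rw [map_add]; exact add_mem hf hg
  | mul_X f i hf =>
    rw [map_mul]
    refine mul_mem hf ?_
    fin_cases i
    · simpa using ha
    · simpa using hb

variable {B : LocalSubring L}

theorem LocalSubring.memMax_aeval_sub (hk : ∀ c : k, algebraMap k L c ∈ B.toSubring)
    (ha : B.MemMax a) (hb : B.MemMax b) (f : MvPolynomial (Fin 2) k) :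
    B.MemMax (MvPolynomial.aeval ![a, b] f -
      algebraMap k L (MvPolynomial.constantCoeff f)) := by
  obtain ⟨g, h, e⟩ := f.exists_eq_C_add_X_mul
  have : MvPolynomial.aeval ![a, b] f - algebraMap k L (MvPolynomial.constantCoeff f) =
      a * MvPolynomial.aeval ![a, b] g + b * MvPolynomial.aeval ![a, b] h := by
    conv_lhs => rw [e]
    simp
    ring
  rw [this]
  exact (ha.mul_right (MvPolynomial.aeval_mem_of_mem hk ha.1 hb.1 g)).add
    (hb.mul_right (MvPolynomial.aeval_mem_of_mem hk ha.1 hb.1 h))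

theorem LocalSubring.not_memMax_algebraMap (hk : ∀ c : k, algebraMap k L c ∈ B.toSubring) {c : k}
    (hc : c ≠ 0) : ¬ B.MemMax (algebraMap k L c) :=
  not_memMax_of_inv_mem (by simpa using hc) (by rw [← map_inv₀]; exact hk _)

theorem LocalSubring.memMax_aeval_iff (hk : ∀ c : k, algebraMap k L c ∈ B.toSubring)
    (ha : B.MemMax a) (hb : B.MemMax b) (f : MvPolynomial (Fin 2) k) :
    B.MemMax (MvPolynomial.aeval ![a, b] f) ↔ MvPolynomial.constantCoeff f = 0 := by
  have h := memMax_aeval_sub hk ha hb f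
  constructor
  · intro h'
    by_contra hc
    exact not_memMax_algebraMap hk hc (by simpa using h'.sub h)
  · intro h'
    simpa [h'] using h

/-- A local ring containing `k` dominates the local ring of the plane at the origin, in the
coordinates `a, b`, as soon as its maximal ideal contains `a` and `b`. -/
theorem origin_le (hk : ∀ c : k, algebraMap k L c ∈ B.toSubring) (ha : B.MemMax a)
    (hb : B.MemMax b) : originLocalRing k a b ≤ B := by
  have hsub : (originLocalRing k a b).toSubring ≤ B.toSubring := by
    rintro _ ⟨f, g, h0, h1, rfl⟩
    rw [div_eq_mul_inv]
    exact mul_mem (MvPolynomial.aeval_mem_of_mem hk ha.1 hb.1 f) (inv_mem_of_not_memMax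
      (MvPolynomial.aeval_mem_of_mem hk ha.1 hb.1 g) (fun h => h0 <|
        (memMax_aeval_iff hk ha hb g).1 h)).2
  refine le_of_memMax hsub ?_
  rintro z hz
  obtain ⟨f, g, h0, h1, rfl⟩ := hz.1
  by_contra hc
  have hf : MvPolynomial.constantCoeff f ≠ 0 := fun hf => hc <| by
    rw [div_eq_mul_inv]
    exact ((memMax_aeval_iff hk ha hb f).2 hf).mul_right (inv_mem_of_not_memMax
      (MvPolynomial.aeval_mem_of_mem hk ha.1 hb.1 g) (fun h => h0 <|
        (memMax_aeval_iff hk ha hb g).1 h)).2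
  have hf0 : MvPolynomial.aeval ![a, b] f ≠ 0 := fun h =>
    hf ((memMax_aeval_iff hk ha hb f).1 (h ▸ memMax_zero))
  refine not_memMax_of_inv_mem (div_ne_zero hf0 h1) ?_ hz
  exact ⟨g, f, hf, hf0, by rw [inv_div]⟩

theorem memMax_of_algebraicIndependent (h : AlgebraicIndependent k ![a, b]) :
    (originLocalRing k a b).MemMax a ∧ (originLocalRing k a b).MemMax b := by
  have key : ∀ i : Fin 2, (originLocalRing k a b).MemMax (![a, b] i) := by
    intro i
    by_contra hc
    have hmem : ![a, b] i ∈ (originLocalRing k a b).toSubring := by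
      fin_cases i
      · exact left_mem_origin k a b
      · exact right_mem_origin k a b
    obtain ⟨h0, f, g, h1, h2, e⟩ := inv_mem_of_not_memMax hmem hc
    have : MvPolynomial.aeval ![a, b] (MvPolynomial.X i * f - g) = 0 := by
      rw [map_sub, map_mul, MvPolynomial.aeval_X]
      rw [inv_eq_iff_eq_inv, inv_div] at e
      rw [eq_div_iff_mul_eq] at e
      · rw [e, sub_self]
      · rintro hf
        rw [hf, div_zero] at e
        exact h0 e
    have h3 := h.eq_zero_of_aeval_eq_zero _ this
    have := congrArg MvPolynomial.constantCoeff h3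
    simp at this
    exact h1 this
  exact ⟨key 0, key 1⟩

/-- The maximal ideal of the local ring at the origin is generated by the coordinates. -/
theorem exists_eq_of_memMax_origin (ha : (originLocalRing k a b).MemMax a)
    (hb : (originLocalRing k a b).MemMax b) {z : L} (hz : (originLocalRing k a b).MemMax z) :
    ∃ r ∈ (originLocalRing k a b).toSubring, ∃ s ∈ (originLocalRing k a b).toSubring,
      z = a * r + b * s := by
  obtain ⟨f, g, h0, h1, rfl⟩ := hz.1
  have hk := algebraMap_mem_origin (k := k) a b
  have hf : MvPolynomial.constantCoeff f = 0 := by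
    rw [← memMax_aeval_iff hk ha hb f]
    have := hz.mul_left (aeval_mem_origin a b g)
    rwa [mul_div_cancel₀ _ h1] at this
  obtain ⟨f1, f2, e⟩ := f.exists_eq_C_add_X_mul
  refine ⟨_, ⟨f1, g, h0, h1, rfl⟩, _, ⟨f2, g, h0, h1, rfl⟩, ?_⟩
  rw [e, hf]
  simp only [map_zero, zero_add, map_add, map_mul, MvPolynomial.aeval_X]
  simp only [Matrix.cons_val_zero, Matrix.cons_val_one]
  ring

/-- The residue field of the local ring at the origin is `k`. -/
theorem exists_memMax_sub_algebraMap (ha : (originLocalRing k a b).MemMax a)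
    (hb : (originLocalRing k a b).MemMax b) {z : L}
    (hz : z ∈ (originLocalRing k a b).toSubring) :
    ∃ c : k, (originLocalRing k a b).MemMax (z - algebraMap k L c) := by
  obtain ⟨f, g, h0, h1, rfl⟩ := hz
  have hk := algebraMap_mem_origin (k := k) a b
  refine ⟨MvPolynomial.constantCoeff f / MvPolynomial.constantCoeff g, ?_⟩
  refine ⟨sub_mem ⟨f, g, h0, h1, rfl⟩ (hk _), ?_⟩
  have h2 : algebraMap k L (MvPolynomial.constantCoeff g) ≠ 0 := by simpa using h0
  have hinv : (MvPolynomial.aeval ![a, b] g)⁻¹ ∈ (originLocalRing k a b).toSubring :=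
    ⟨1, g, h0, h1, by simp⟩
  have e : MvPolynomial.aeval ![a, b] f / MvPolynomial.aeval ![a, b] g -
      algebraMap k L (MvPolynomial.constantCoeff f / MvPolynomial.constantCoeff g) =
      (MvPolynomial.aeval ![a, b] g)⁻¹ * (algebraMap k L (MvPolynomial.constantCoeff g))⁻¹ *
       (algebraMap k L (MvPolynomial.constantCoeff g) *
        (MvPolynomial.aeval ![a, b] f - algebraMap k L (MvPolynomial.constantCoeff f)) -
        algebraMap k L (MvPolynomial.constantCoeff f) *
        (MvPolynomial.aeval ![a, b] g - algebraMap k L (MvPolynomial.constantCoeff g))) := by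
    rw [map_div₀]
    field_simp
    ring
  have : (originLocalRing k a b).MemMax (MvPolynomial.aeval ![a, b] f / MvPolynomial.aeval ![a, b] g -
      algebraMap k L (MvPolynomial.constantCoeff f / MvPolynomial.constantCoeff g)) := by
    rw [e]
    refine MemMax.mul_left (mul_mem hinv ?_) (((memMax_aeval_sub hk ha hb f).mul_left (hk _)).sub
      ((memMax_aeval_sub hk ha hb g).mul_left (hk _)))
    rw [← map_inv₀]
    exact hk _
  exact this.2

end Origin

/-! ### Regularity of the local ring at the origin -/

section TwoGenerators

variable {R : Type*} [CommRing R] [IsNoetherianRing R] [IsLocalRing R] {a b : R}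

theorem isDiscreteValuationRing_quotient_of_maximalIdeal_eq_span_pair
    (hm : maximalIdeal R = Ideal.span {a, b}) (hp : (Ideal.span {a}).IsPrime)
    (hb : b ∉ Ideal.span {a}) :
    ∃ (_ : IsDomain (R ⧸ Ideal.span {a})) (_ : IsDiscreteValuationRing (R ⧸ Ideal.span {a})),
      Irreducible (Ideal.Quotient.mk (Ideal.span {a}) b) := by
  have hd : IsDomain (R ⧸ Ideal.span {a}) := Ideal.Quotient.isDomain _
  have hl : IsLocalRing (R ⧸ Ideal.span {a}) :=
    IsLocalRing.of_surjective' (Ideal.Quotient.mk _) Ideal.Quotient.mk_surjective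
  have hmax : maximalIdeal (R ⧸ Ideal.span {a}) =
      Ideal.span {Ideal.Quotient.mk (Ideal.span {a}) b} := by
    rw [← IsLocalRing.map_maximalIdeal_of_surjective (Ideal.Quotient.mk (Ideal.span {a}))
      Ideal.Quotient.mk_surjective, hm, Ideal.map_span, Set.image_pair,
      Ideal.Quotient.eq_zero_iff_mem.2 (Ideal.mem_span_singleton_self a), Ideal.span_insert_zero]
  have hnf : ¬ IsField (R ⧸ Ideal.span {a}) := by
    rw [IsLocalRing.isField_iff_maximalIdeal_eq, hmax, Ideal.span_singleton_eq_bot,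
      Ideal.Quotient.eq_zero_iff_mem]
    exact hb
  have hprin : (maximalIdeal (R ⧸ Ideal.span {a})).IsPrincipal := ⟨⟨_, hmax⟩⟩
  have hdvr : IsDiscreteValuationRing (R ⧸ Ideal.span {a}) :=
    ((IsDiscreteValuationRing.TFAE _ hnf).out 0 4).2 hprin
  exact ⟨hd, hdvr, (IsDiscreteValuationRing.irreducible_iff_uniformizer _).2 hmax⟩

theorem isRegularLocalRing_of_maximalIdeal_eq_span_pair
    (hm : maximalIdeal R = Ideal.span {a, b}) (hp : (Ideal.span {a}).IsPrime)
    (hb : b ∉ Ideal.span {a}) (ha : a ∈ nonZeroDivisors R) :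
    IsRegularLocalRing R ∧ ringKrullDim R = 2 := by
  obtain ⟨hd, hdvr, -⟩ := isDiscreteValuationRing_quotient_of_maximalIdeal_eq_span_pair hm hp hb
  have h1 := ringKrullDim_quotient_succ_le_of_nonZeroDivisor ha
  rw [IsDiscreteValuationRing.ringKrullDim_eq_one] at h1
  have h2 : (2 : WithBot ℕ∞) ≤ ringKrullDim R := by
    rw [← one_add_one_eq_two]; exact h1
  have h3 : (maximalIdeal R).spanFinrank ≤ 2 := by
    rw [hm]
    exact (Submodule.spanFinrank_span_le_ncard_of_finite (Set.toFinite _)).trans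
      (Set.ncard_insert_le _ _ |>.trans (by simp))
  have h4 : ((maximalIdeal R).spanFinrank : WithBot ℕ∞) ≤ 2 := by exact_mod_cast h3
  exact ⟨IsRegularLocalRing.of_spanFinrank_maximalIdeal_le R (h4.trans h2),
    le_antisymm ((ringKrullDim_le_spanFinrank_maximalIdeal R).trans h4) h2⟩

/-- An ideal containing a power of the maximal ideal of a local ring of dimension two cannot be
principal: this is Krull's principal ideal theorem. -/
theorem IsLocalRing.not_maximalIdeal_pow_le_span_singleton
    (hdim : ringKrullDim R = 2) {s : R} (hs : s ∈ maximalIdeal R) {n : ℕ}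
    (h : maximalIdeal R ^ n ≤ Ideal.span {s}) : False := by
  have hmin : maximalIdeal R ∈ (Ideal.span {s}).minimalPrimes := by
    refine ⟨⟨inferInstance, by simpa [Ideal.span_le] using hs⟩, ?_⟩
    rintro q ⟨hq, hsq⟩ -
    exact hq.le_of_pow_le (h.trans hsq)
  have h1 := Ideal.height_le_one_of_isPrincipal_of_mem_minimalPrimes (Ideal.span {s}) _ hmin
  have h2 := IsLocalRing.maximalIdeal_height_eq_ringKrullDim (R := R)
  rw [hdim] at h2
  have h3 : (maximalIdeal R).height = 2 := WithBot.coe_injective h2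
  rw [h3] at h1
  exact absurd h1 (by decide)

end TwoGenerators

section Origin

open LocalSubring

variable {L : Type*} [Field L] {k : Type*} [Field k] [Algebra k L] {a b : L}

/-- The evaluation map from polynomials to the local ring at the origin. -/
noncomputable def evalOrigin (k : Type*) [Field k] [Algebra k L] (a b : L) :
    MvPolynomial (Fin 2) k →+* (originLocalRing k a b).toSubring :=
  (MvPolynomial.aeval ![a, b] : MvPolynomial (Fin 2) k →ₐ[k] L).toRingHom.codRestrict _
    (aeval_mem_origin a b)

/-- The polynomials that do not vanish at the origin. -/
def unitsAtOrigin (k : Type*) [Field k] : Submonoid (MvPolynomial (Fin 2) k) where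
  carrier := {f | MvPolynomial.constantCoeff f ≠ 0}
  mul_mem' {f g} hf hg := by simpa using ⟨hf, hg⟩
  one_mem' := by simp

theorem mem_unitsAtOrigin {f : MvPolynomial (Fin 2) k} :
    f ∈ unitsAtOrigin k ↔ MvPolynomial.constantCoeff f ≠ 0 := Iff.rfl

theorem isLocalization_evalOrigin (h : AlgebraicIndependent k ![a, b]) :
    letI := (evalOrigin k a b).toAlgebra
    IsLocalization (unitsAtOrigin k) (originLocalRing k a b).toSubring := by
  let := (evalOrigin k a b).toAlgebra
  have hne : ∀ f ∈ unitsAtOrigin k, MvPolynomial.aeval ![a, b] f ≠ 0 := by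
    intro f hf h0
    rw [h.eq_zero_of_aeval_eq_zero f h0] at hf
    simp [mem_unitsAtOrigin] at hf
  refine ⟨⟨?_, ?_, ?_⟩⟩
  · rintro ⟨f, hf⟩
    refine IsUnit.of_mul_eq_one ⟨1 / MvPolynomial.aeval ![a, b] f,
      1, f, hf, hne f hf, by simp⟩ (Subtype.ext ?_)
    exact mul_one_div_cancel (hne f hf)
  · rintro ⟨z, f, g, h0, h1, hz⟩
    refine ⟨(f, ⟨g, h0⟩), Subtype.ext ?_⟩
    change z * MvPolynomial.aeval ![a, b] g = MvPolynomial.aeval ![a, b] f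
    rw [hz, div_mul_cancel₀ _ h1]
  · intro f g hfg
    have h1 : MvPolynomial.aeval ![a, b] f = MvPolynomial.aeval ![a, b] g :=
      congrArg Subtype.val hfg
    exact ⟨1, by rw [h h1]⟩

/-- For algebraically independent coordinates the local ring at the origin is a localization of a
polynomial ring. The first coordinate is then a prime element that does not divide the second one,
which is all that is needed for regularity. -/
theorem origin_structure (h : AlgebraicIndependent k ![a, b]) :
    IsNoetherianRing (originLocalRing k a b).toSubring ∧
    maximalIdeal (originLocalRing k a b).toSubring =
      Ideal.span {⟨a, left_mem_origin k a b⟩, ⟨b, right_mem_origin k a b⟩} ∧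
    (Ideal.span {(⟨a, left_mem_origin k a b⟩ : (originLocalRing k a b).toSubring)}).IsPrime ∧
    (⟨b, right_mem_origin k a b⟩ : (originLocalRing k a b).toSubring) ∉
      Ideal.span {(⟨a, left_mem_origin k a b⟩ : (originLocalRing k a b).toSubring)} := by
  let := (evalOrigin k a b).toAlgebra
  have hloc : IsLocalization (unitsAtOrigin k) (originLocalRing k a b).toSubring :=
    isLocalization_evalOrigin h
  obtain ⟨ha, hb⟩ := memMax_of_algebraicIndependent h
  refine ⟨IsLocalization.isNoetherianRing (unitsAtOrigin k) _ inferInstance, ?_, ?_, ?_⟩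
  · apply le_antisymm
    · intro z hz
      obtain ⟨r, hr, s, hs, e⟩ := exists_eq_of_memMax_origin ha hb (memMax_coe.2 hz)
      rw [Ideal.mem_span_pair]
      exact ⟨⟨r, hr⟩, ⟨s, hs⟩, Subtype.ext (by simp [e, mul_comm])⟩
    · rw [Ideal.span_le, Set.insert_subset_iff, Set.singleton_subset_iff]
      exact ⟨ha.2, hb.2⟩
  · have hX : (Ideal.span {(MvPolynomial.X 0 : MvPolynomial (Fin 2) k)}).IsPrime :=
      (Ideal.span_singleton_prime (MvPolynomial.X_ne_zero 0)).2 MvPolynomial.X_prime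
    have := IsLocalization.isPrime_of_isPrime_disjoint (unitsAtOrigin k)
      (originLocalRing k a b).toSubring _ hX ?_
    · rw [Ideal.map_span, Set.image_singleton] at this
      convert! this
      change a = MvPolynomial.aeval ![a, b] (MvPolynomial.X 0)
      simp
    · rw [Set.disjoint_left]
      intro f hf hf'
      obtain ⟨g, rfl⟩ := Ideal.mem_span_singleton.1 hf'
      exact mem_unitsAtOrigin.1 hf (by simp)
  · intro hmem
    obtain ⟨⟨z, f, g, h0, h1, hz⟩, e⟩ := Ideal.mem_span_singleton.1 hmem
    have e' : b = a * z := congrArg Subtype.val e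
    have h2 : MvPolynomial.aeval ![a, b] (MvPolynomial.X 1 * g) =
        MvPolynomial.aeval ![a, b] (MvPolynomial.X 0 * f) := by
      simp only [map_mul, MvPolynomial.aeval_X, Matrix.cons_val_zero, Matrix.cons_val_one]
      rw [mul_comm, ← div_mul_cancel₀ (MvPolynomial.aeval ![a, b] f) h1, ← hz, ← mul_assoc, ← e',
        mul_comm]
    have h3 : MvPolynomial.X 1 * g = MvPolynomial.X 0 * f := h h2
    rcases (MvPolynomial.X_prime (R := k) (i := (0 : Fin 2))).dvd_or_dvd ⟨f, h3⟩ with h4 | ⟨g', rfl⟩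
    · rw [MvPolynomial.X_dvd_X] at h4
      simp at h4
    · simp at h0

theorem isRegularParameters_origin (h : AlgebraicIndependent k ![a, b]) :
    IsRegularParameters (originLocalRing k a b) a b := by
  obtain ⟨h1, h2, h3, h4⟩ := origin_structure h
  have h5 := isRegularLocalRing_of_maximalIdeal_eq_span_pair h2 h3 h4
    (mem_nonZeroDivisors_of_ne_zero fun h0 => h.ne_zero 0 (congrArg Subtype.val h0))
  exact ⟨h5.1, h5.2, _, _, rfl, rfl, h2⟩

end Origin

/-! ### Quadratic transforms -/

section QuadraticTransforms

open LocalSubring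

variable {L : Type*} [Field L] {B B' B'' V : LocalSubring L}

theorem LocalSubring.mem_ofPrime_iff {A : Subring L} {P : Ideal A} [P.IsPrime] {z : L} :
    z ∈ (LocalSubring.ofPrime A P).toSubring ↔ ∃ x ∈ A, ∃ w : A, w ∉ P ∧ z = x / w := by
  constructor
  · rintro hz
    obtain ⟨⟨x, w⟩, h⟩ := IsLocalization.surj P.primeCompl
      (⟨z, hz⟩ : (LocalSubring.ofPrime A P).toSubring)
    refine ⟨x, x.2, w, w.2, ?_⟩
    have hw : ((w : A) : L) ≠ 0 := fun h0 => w.2 (by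
      have : (w : A) = 0 := Subtype.ext h0
      rw [this]; exact P.zero_mem)
    rw [eq_div_iff hw]
    exact congrArg Subtype.val h
  · rintro ⟨x, hx, w, hw, rfl⟩
    have hu := IsLocalization.map_units (LocalSubring.ofPrime A P).toSubring
      (⟨w, hw⟩ : P.primeCompl)
    obtain ⟨y, hy⟩ := hu.exists_right_inv
    have hy' : (w : L) * (y : L) = 1 := congrArg Subtype.val hy
    rw [div_eq_mul_inv, inv_eq_of_mul_eq_one_right hy']
    exact mul_mem (LocalSubring.le_ofPrime A P hx) y.2

theorem blowupChart_le {S : Subring L} {s : L} (h : B.toSubring ≤ S)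
    (h' : ∀ z, B.MemMax z → z / s ∈ S) : blowupChart B s ≤ S := by
  refine (Subring.closure_le).2 (Set.union_subset h ?_)
  rintro _ ⟨z, hz, rfl⟩
  exact h' _ (memMax_coe.2 hz)

theorem div_mem_blowupChart {s z : L} (hz : B.MemMax z) : z / s ∈ blowupChart B s :=
  Subring.subset_closure (Or.inr ⟨⟨z, hz.1⟩, hz.2, rfl⟩)

theorem IsQuadraticTransform.exists_generator (h : IsQuadraticTransform B B') :
    ∃ s, B.MemMax s ∧ s ≠ 0 ∧ blowupChart B s ≤ B'.toSubring ∧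
      ∀ z ∈ B'.toSubring, ∃ x ∈ blowupChart B s, ∃ w ∈ blowupChart B s,
        w ≠ 0 ∧ w⁻¹ ∈ B'.toSubring ∧ z = x / w := by
  obtain ⟨s, hs, hs0, P, hP, hcomap, rfl⟩ := h
  refine ⟨s, memMax_coe.2 hs, fun h => hs0 (Subtype.ext h), LocalSubring.le_ofPrime _ _, ?_⟩
  intro z hz
  obtain ⟨x, hx, w, hw, rfl⟩ := LocalSubring.mem_ofPrime_iff.1 hz
  refine ⟨x, hx, w, w.2, ?_, LocalSubring.mem_ofPrime_iff.2 ⟨1, one_mem _, w, hw, by simp⟩, rfl⟩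
  rintro h0
  exact hw ((Subtype.ext h0 : w = 0) ▸ P.zero_mem)

theorem IsQuadraticTransform.toSubring_le (h : IsQuadraticTransform B B') :
    B.toSubring ≤ B'.toSubring := by
  obtain ⟨s, -, -, h1, -⟩ := h.exists_generator
  exact (le_blowupChart B s).trans h1

theorem isQuadraticTransform_of_le {s : L} (hs : B.MemMax s) (hs0 : s ≠ 0) (hle : B ≤ B')
    (h : ∀ z, B.MemMax z → z / s ∈ B'.toSubring)
    (h' : ∀ z ∈ B'.toSubring, ∃ x ∈ blowupChart B s, ∃ w ∈ blowupChart B s,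
      ¬ B'.MemMax w ∧ z = x / w) : IsQuadraticTransform B B' := by
  have hc : blowupChart B s ≤ B'.toSubring := blowupChart_le hle.1 h
  let P : Ideal (blowupChart B s) := (maximalIdeal B'.toSubring).comap (Subring.inclusion hc)
  have hP : P.IsPrime := Ideal.comap_isPrime _ _
  have hmem : ∀ w : blowupChart B s, w ∈ P ↔ B'.MemMax (w : L) :=
    fun w => ⟨fun hw => ⟨hc w.2, hw⟩, fun hw => hw.2⟩
  refine ⟨⟨s, hs.1⟩, hs.2, fun h => hs0 (congrArg Subtype.val h), P, hP, ?_, ?_⟩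
  · ext z
    rw [Ideal.mem_comap]
    change Subring.inclusion (le_blowupChart B s) z ∈ P ↔ _
    rw [hmem, ← memMax_coe, memMax_iff_of_le hle z.2]
    rfl
  · apply LocalSubring.toSubring_injective
    ext z
    change _ ↔ z ∈ (LocalSubring.ofPrime (blowupChart B s) P).toSubring
    rw [LocalSubring.mem_ofPrime_iff]
    constructor
    · intro hz
      obtain ⟨x, hx, w, hw, hw', e⟩ := h' z hz
      exact ⟨x, hx, ⟨w, hw⟩, fun hc => hw' ((hmem _).1 hc), e⟩
    · rintro ⟨x, hx, w, hw, rfl⟩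
      rw [div_eq_mul_inv]
      exact mul_mem (hc hx) (inv_mem_of_not_memMax (hc w.2) (fun hm => hw ((hmem w).2 hm))).2

/-- The quadratic transform along a valuation is unique; here the valuation ring may be any local
subring `V`. The comparison works because the two denominators differ by a unit of `V`. -/
theorem IsQuadraticTransform.toSubring_le_of_le (h' : IsQuadraticTransform B B')
    (h'' : IsQuadraticTransform B B'') (hV' : B' ≤ V) (hV'' : B'' ≤ V) :
    B'.toSubring ≤ B''.toSubring := by
  obtain ⟨s, hs, hs0, hc, hq⟩ := h'.exists_generator
  obtain ⟨t, ht, ht0, hd, -⟩ := h''.exists_generator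
  -- an element of `B''` that is a unit of `V` is a unit of `B''`
  have key : ∀ w ∈ B''.toSubring, w ≠ 0 → w⁻¹ ∈ B'.toSubring → w⁻¹ ∈ B''.toSubring := by
    intro w hw h0 hi
    refine (inv_mem_of_not_memMax hw fun hm => ?_).2
    exact not_memMax_of_inv_mem h0 (hV'.1 hi) (hm.of_le hV'')
  have hst : (s / t)⁻¹ ∈ B''.toSubring := by
    refine key _ (hd (div_mem_blowupChart hs)) (div_ne_zero hs0 ht0) ?_
    rw [inv_div]
    exact hc (div_mem_blowupChart ht)
  have hchart : blowupChart B s ≤ B''.toSubring := by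
    refine blowupChart_le h''.toSubring_le fun z hz => ?_
    have : z / s = z / t * (s / t)⁻¹ := by field_simp
    rw [this]
    exact mul_mem (hd (div_mem_blowupChart hz)) hst
  intro z hz
  obtain ⟨x, hx, w, hw, hw0, hwi, rfl⟩ := hq z hz
  rw [div_eq_mul_inv]
  exact mul_mem (hchart hx) (key w (hchart hw) hw0 hwi)

theorem IsQuadraticTransform.eq_of_le (h' : IsQuadraticTransform B B')
    (h'' : IsQuadraticTransform B B'') (hV' : B' ≤ V) (hV'' : B'' ≤ V) : B' = B'' :=
  toSubring_injective <| le_antisymm (h'.toSubring_le_of_le h'' hV' hV'')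
    (h''.toSubring_le_of_le h' hV'' hV')

/-- The maximal ideal of `B` generates a principal ideal in every local ring containing a
quadratic transform of `B`. -/
theorem IsQuadraticTransform.exists_dvd (h : IsQuadraticTransform B B') :
    ∃ s, B.MemMax s ∧ s ≠ 0 ∧ ∀ z, B.MemMax z → z / s ∈ B'.toSubring := by
  obtain ⟨s, hs, hs0, hc, -⟩ := h.exists_generator
  exact ⟨s, hs, hs0, fun z hz => hc (div_mem_blowupChart hz)⟩

theorem LocalSubring.exists_eq_of_memMax {s t : L} (h : IsRegularParameters B s t) {z : L}
    (hz : B.MemMax z) : ∃ x ∈ B.toSubring, ∃ y ∈ B.toSubring, z = s * x + t * y := by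
  obtain ⟨-, -, s', t', rfl, rfl, hm⟩ := h
  have := hz.2
  rw [hm, Ideal.mem_span_pair] at this
  obtain ⟨x, y, e⟩ := this
  exact ⟨x, x.2, y, y.2, by rw [mul_comm, mul_comm (t' : L)]; exact (congrArg Subtype.val e).symm⟩

theorem IsRegularParameters.memMax {s t : L} (h : IsRegularParameters B s t) :
    B.MemMax s ∧ B.MemMax t := by
  obtain ⟨-, -, s', t', rfl, rfl, hm⟩ := h
  rw [memMax_coe, memMax_coe, hm]
  exact ⟨Ideal.subset_span (by simp), Ideal.subset_span (by simp)⟩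

/-- The maximal ideal of a two-dimensional local ring has no power contained in a proper principal
ideal. -/
theorem LocalSubring.false_of_forall_div_mem {s : L} (h1 : IsRegularLocalRing B.toSubring)
    (h2 : ringKrullDim B.toSubring = 2) (hs : B.MemMax s) (hs0 : s ≠ 0) {I : Ideal B.toSubring}
    {n : ℕ} (hI : maximalIdeal B.toSubring ^ n ≤ I)
    (h : ∀ z ∈ I, (z : L) / s ∈ B.toSubring) : False := by
  refine IsLocalRing.not_maximalIdeal_pow_le_span_singleton h2 hs.2 (n := n) (hI.trans ?_)
  intro z hz
  rw [Ideal.mem_span_singleton]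
  exact ⟨⟨_, h z hz⟩, Subtype.ext (by simp [mul_div_cancel₀ _ hs0])⟩

theorem toSubring_le_of_reflTransGen {r : LocalSubring L → LocalSubring L → Prop}
    (hr : ∀ C D, r C D → IsQuadraticTransform C D) (h : Relation.ReflTransGen r B B') :
    B.toSubring ≤ B'.toSubring := by
  induction h with
  | refl => exact le_rfl
  | tail _ h2 ih => exact ih.trans (hr _ _ h2).toSubring_le

/-- Two different members of a sequence of quadratic transforms do not have a common system of
regular parameters. -/
theorem eq_of_reflTransGen_of_isRegularParameters {r : LocalSubring L → LocalSubring L → Prop}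
    (hr : ∀ C D, r C D → IsQuadraticTransform C D) (h : Relation.ReflTransGen r B B') {s t : L}
    (hB : IsRegularParameters B s t) (hB' : IsRegularParameters B' s t) : B = B' := by
  rcases Relation.ReflTransGen.cases_head h with h | ⟨C, h1, h2⟩
  · exact h
  · exfalso
    obtain ⟨w, hw, hw0, hdiv⟩ := (hr _ _ h1).exists_dvd
    have hle : C.toSubring ≤ B'.toSubring := toSubring_le_of_reflTransGen hr h2
    have hle' : B.toSubring ≤ B'.toSubring := (hr _ _ h1).toSubring_le.trans hle
    have hw' : B'.MemMax w := by
      obtain ⟨x, hx, y, hy, rfl⟩ := exists_eq_of_memMax hB hw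
      exact (hB'.memMax.1.mul_right (hle' hx)).add (hB'.memMax.2.mul_right (hle' hy))
    refine false_of_forall_div_mem hB'.1 hB'.2.1 hw' hw0 (pow_one _).le fun z hz => ?_
    obtain ⟨x, hx, y, hy, e⟩ := exists_eq_of_memMax hB' (memMax_coe.2 hz)
    rw [e, add_div, mul_div_right_comm, mul_div_right_comm]
    exact add_mem (mul_mem (hle (hdiv _ hB.memMax.1)) hx) (mul_mem (hle (hdiv _ hB.memMax.2)) hy)

end QuadraticTransforms

/-! ### Valuations -/

section Valuations

open LocalSubring

variable {L : Type*} [Field L]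

/-- The valuation ring of an additive valuation, as a local subring. -/
def AddValuation.localSubring (ν : AddValuation L (WithTop ℚ)) : LocalSubring L :=
  @LocalSubring.mk L _
    { carrier := {z | 0 ≤ ν z}
      mul_mem' := fun {a b} ha hb => by
        change 0 ≤ ν (a * b)
        rw [AddValuation.map_mul]
        exact add_nonneg ha hb
      one_mem' := by simp
      add_mem' := fun {a b} ha hb => (le_min ha hb).trans (ν.map_add a b)
      zero_mem' := by simp
      neg_mem' := fun {a} ha => by simpa using ha } (by
    refine IsLocalRing.of_isUnit_or_isUnit_one_sub_self ?_
    have key : ∀ z : L, ν z = 0 → z ≠ 0 ∧ 0 ≤ ν z⁻¹ := by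
      intro z hz
      have h0 : z ≠ 0 := by rintro rfl; simp at hz
      refine ⟨h0, ?_⟩
      have : ν z + ν z⁻¹ = 0 := by rw [← AddValuation.map_mul, mul_inv_cancel₀ h0, AddValuation.map_one]
      rw [hz, zero_add] at this
      exact this.ge
    rintro ⟨z, hz⟩
    rcases (show 0 ≤ ν z from hz).lt_or_eq with h | h
    · right
      have h1 : ν (1 - z) = 0 :=
        (ν.map_sub_eq_of_lt_left (by simpa using h)).trans ν.map_one
      exact IsUnit.of_mul_eq_one ⟨(1 - z)⁻¹, (key _ h1).2⟩
        (Subtype.ext (mul_inv_cancel₀ (key _ h1).1))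
    · left
      exact IsUnit.of_mul_eq_one ⟨z⁻¹, (key _ h.symm).2⟩
        (Subtype.ext (mul_inv_cancel₀ (key _ h.symm).1)))

variable {ν : AddValuation L (WithTop ℚ)}

theorem AddValuation.mem_localSubring {z : L} : z ∈ ν.localSubring.toSubring ↔ 0 ≤ ν z := Iff.rfl

theorem AddValuation.memMax_localSubring {z : L} : ν.localSubring.MemMax z ↔ 0 < ν z := by
  constructor
  · intro h
    refine lt_of_le_of_ne h.1 fun h0 => ?_
    have h1 : z ≠ 0 := by rintro rfl; simp at h0
    refine not_memMax_of_inv_mem h1 ?_ h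
    have : ν z + ν z⁻¹ = 0 := by
      rw [← AddValuation.map_mul, mul_inv_cancel₀ h1, AddValuation.map_one]
    rw [← h0, zero_add] at this
    exact this.ge
  · intro h
    by_contra hc
    obtain ⟨h1, h2⟩ := inv_mem_of_not_memMax (B := ν.localSubring) h.le hc
    have : ν z + ν z⁻¹ = 0 := by
      rw [← AddValuation.map_mul, mul_inv_cancel₀ h1, AddValuation.map_one]
    exact (add_pos_of_pos_of_nonneg h h2).ne' this

theorem valuationDominates_iff {B : LocalSubring L} :
    ValuationDominates ν B ↔ B ≤ ν.localSubring := by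
  constructor
  · intro h
    exact le_of_memMax (fun z hz => (h ⟨z, hz⟩).1)
      fun z hz => AddValuation.memMax_localSubring.2 ((h ⟨z, hz.1⟩).2.1 hz.2)
  · intro h b
    exact ⟨h.1 b.2, by rw [← memMax_coe, memMax_iff_of_le h b.2, AddValuation.memMax_localSubring]⟩

theorem isQuadraticTransformAlong_iff {B B' : LocalSubring L} :
    IsQuadraticTransformAlong ν B B' ↔ IsQuadraticTransform B B' ∧ B' ≤ ν.localSubring := by
  rw [IsQuadraticTransformAlong, valuationDominates_iff]

theorem isQuadraticTransformAlong_rightUnique :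
    Relator.RightUnique (IsQuadraticTransformAlong ν) := by
  intro B B' B'' h' h''
  rw [isQuadraticTransformAlong_iff] at h' h''
  exact h'.1.eq_of_le h''.1 h'.2 h''.2

theorem IsTransformSequence.unique {B₁ : LocalSubring L} {s t : ℕ → L} {A B : ℕ → LocalSubring L}
    (hA : IsTransformSequence ν B₁ s t A) (hB : IsTransformSequence ν B₁ s t B) {j : ℕ}
    (hj : 1 ≤ j) : A j = B j := by
  induction j, hj using Nat.le_induction with
  | base => rw [hA.first, hB.first]
  | succ j hj ih =>
    have h1 := hA.step j hj
    have h2 := hB.step j hj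
    rw [ih] at h1
    have hr : ∀ C D, IsQuadraticTransformAlong ν C D → IsQuadraticTransform C D := fun _ _ h => h.1
    rcases h1.total_of_right_unique isQuadraticTransformAlong_rightUnique h2 with h | h
    · exact eq_of_reflTransGen_of_isRegularParameters hr h (hA.parameters _ (by lia))
        (hB.parameters _ (by lia))
    · exact (eq_of_reflTransGen_of_isRegularParameters hr h (hB.parameters _ (by lia))
        (hA.parameters _ (by lia))).symm

end Valuations

/-! ### Pairs of elements forming a transcendence basis -/

section TranscendenceBasis

variable {L : Type*} [Field L] {k : Type*} [Field k] [Algebra k L] {a b a' b' : L}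

/-- A pair of elements over which both members of a transcendence basis are algebraic is itself a
transcendence basis. -/
theorem IsTranscendenceBasis.pair_of_isAlgebraic (h : IsTranscendenceBasis k ![a, b])
    (ha : IsAlgebraic (Algebra.adjoin k {a', b'}) a)
    (hb : IsAlgebraic (Algebra.adjoin k {a', b'}) b) : IsTranscendenceBasis k ![a', b'] := by
  have hr : Set.range ![a', b'] = {a', b'} := by simp [Matrix.range_cons, Set.pair_comm]
  have hr' : Set.range ![a, b] = {a, b} := by simp [Matrix.range_cons, Set.pair_comm]
  have h1 : Algebra.IsAlgebraic (Algebra.adjoin k {a, b}) L := hr' ▸ h.isAlgebraic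
  have h2 : Algebra.IsAlgebraic (Algebra.adjoin k (Set.range ![a', b'])) L := by
    rw [hr]
    rw [← AlgebraicIndependent.matroid_spanning_iff] at h1 ⊢
    have h3 : ({a, b} : Set L) ⊆ (AlgebraicIndependent.matroid k L).closure {a', b'} := by
      rw [AlgebraicIndependent.matroid_closure_eq]
      rintro z (rfl | rfl)
      · exact ha
      · exact hb
    rw [Matroid.spanning_iff_ground_subset_closure]
    rw [Matroid.spanning_iff_ground_subset_closure] at h1
    exact h1.trans (Matroid.closure_subset_closure_of_subset_closure h3)
  refine Algebra.IsAlgebraic.isTranscendenceBasis_of_lift_le_trdeg_of_finite k ![a', b'] ?_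
  rw [← h.lift_cardinalMk_eq_trdeg]

theorem isAlgebraic_of_mul_eq {R : Type*} [CommRing R] [Algebra R L] [FaithfulSMul R L] {r s : R}
    (hr : r ≠ 0) (h : algebraMap R L r * a = algebraMap R L s) : IsAlgebraic R a := by
  refine ⟨Polynomial.C r * Polynomial.X - Polynomial.C s, fun h0 => hr ?_, by simp [h]⟩
  simpa using congrArg (Polynomial.coeff · 1) h0

end TranscendenceBasis

/-! ### Chains of parameters -/

section Chains

open LocalSubring

variable {L : Type*} [Field L]

/-- The factor `1 + t n` for `n ≥ 2`, and `1` for `n = 0, 1`. -/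
noncomputable def chainUnit (t : ℕ → L) (n : ℕ) : L := if n < 2 then 1 else 1 + t n

/-- A sequence in which any two consecutive members are coordinates of the plane up to an algebraic
extension, and where the next member is, up to a unit, the strict transform of
`t (n + 1) ^ e n - t n` after `e n` blowups. -/
structure IsParameterChain (k : Type*) [Field k] [Algebra k L] (e : ℕ → ℕ) (t : ℕ → L) :
    Prop where
  basis : ∀ n, IsTranscendenceBasis k ![t n, t (n + 1)]
  rel : ∀ n, (1 + t (n + 2)) * t n = chainUnit t n * t (n + 1) ^ e n
  pos : ∀ n, 2 ≤ e n

/-- The local ring with parameters `t n, t (n + 1)`. -/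
noncomputable def chainRing (k : Type*) [Field k] [Algebra k L] (t : ℕ → L) (n : ℕ) :
    LocalSubring L := originLocalRing k (t n) (t (n + 1))

variable {k : Type*} [Field k] [Algebra k L]

theorem IsTranscendenceBasis.pair_of_chain_rel {a b c ε : L} {e : ℕ}
    (h : IsTranscendenceBasis k ![a, b]) (hε : ε = 1 ∨ ε = 1 + a)
    (hr : (1 + c) * a = ε * b ^ e) : IsTranscendenceBasis k ![b, c] := by
  have hb0 : b ≠ 0 := h.1.ne_zero 1
  have hbm : b ∈ Algebra.adjoin k {b, c} := Algebra.subset_adjoin (by simp)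
  have hcm : c ∈ Algebra.adjoin k {b, c} := Algebra.subset_adjoin (by simp)
  refine h.pair_of_isAlgebraic ?_ (isAlgebraic_algebraMap
    (⟨b, hbm⟩ : Algebra.adjoin k {b, c}))
  have hs : b ^ e ∈ Algebra.adjoin k {b, c} := pow_mem hbm e
  rcases hε with rfl | rfl
  · refine isAlgebraic_of_mul_eq (r := (⟨1 + c, add_mem (one_mem _) hcm⟩ : Algebra.adjoin k {b, c}))
      (s := ⟨b ^ e, hs⟩) (fun h0 => ?_) (by simpa using hr)
    have h0' : 1 + c = 0 := congrArg Subtype.val h0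
    rw [h0', zero_mul, one_mul] at hr
    exact pow_ne_zero e hb0 hr.symm
  · refine isAlgebraic_of_mul_eq
      (r := (⟨1 + c - b ^ e, sub_mem (add_mem (one_mem _) hcm) hs⟩ : Algebra.adjoin k {b, c}))
      (s := ⟨b ^ e, hs⟩) (fun h0 => ?_) ?_
    · have h0' : 1 + c - b ^ e = 0 := congrArg Subtype.val h0
      have : b ^ e = 0 := by linear_combination a * h0' - hr
      exact pow_ne_zero e hb0 this
    · change (1 + c - b ^ e) * a = b ^ e
      linear_combination hr

theorem chainUnit_eq_or (t : ℕ → L) (n : ℕ) : chainUnit t n = 1 ∨ chainUnit t n = 1 + t n := by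
  rw [chainUnit]
  split_ifs
  · exact Or.inl rfl
  · exact Or.inr rfl

namespace IsParameterChain

variable {e : ℕ → ℕ} {t : ℕ → L}

theorem indep (h : IsParameterChain k e t) (n : ℕ) : AlgebraicIndependent k ![t n, t (n + 1)] :=
  (h.basis n).1

theorem ne_zero (h : IsParameterChain k e t) (n : ℕ) : t n ≠ 0 := (h.indep n).ne_zero 0

theorem memMax_left (h : IsParameterChain k e t) (n : ℕ) : (chainRing k t n).MemMax (t n) :=
  (memMax_of_algebraicIndependent (h.indep n)).1

theorem memMax_right (h : IsParameterChain k e t) (n : ℕ) :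
    (chainRing k t n).MemMax (t (n + 1)) := (memMax_of_algebraicIndependent (h.indep n)).2

/-- In the ring with parameters `t (n + 1), t (n + 2)` the element `t n` is a unit times the
`e n`-th power of `t (n + 1)`. -/
theorem exists_eq_pow_mul (h : IsParameterChain k e t) (n : ℕ) :
    ∃ κ, (chainRing k t (n + 1)).MemMax (κ - 1) ∧ t n = t (n + 1) ^ e n * κ := by
  have hb : (chainRing k t (n + 1)).MemMax (t (n + 1)) := h.memMax_left (n + 1)
  have hc : (chainRing k t (n + 1)).MemMax (t (n + 2)) := h.memMax_right (n + 1)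
  have hbe := hb.pow (n := e n) (by have := h.pos n; lia)
  have key : ∀ d, (chainRing k t (n + 1)).MemMax d → (1 + d) * t n = t (n + 1) ^ e n →
      ∃ κ, (chainRing k t (n + 1)).MemMax (κ - 1) ∧ t n = t (n + 1) ^ e n * κ := by
    intro d hd hr
    obtain ⟨h0, hi⟩ := inv_mem_of_not_memMax (add_mem (one_mem _) hd.1) (not_memMax_one_add hd)
    refine ⟨(1 + d)⁻¹, ?_, ?_⟩
    · have : (1 + d)⁻¹ - 1 = -(1 + d)⁻¹ * d := by field_simp; ring
      rw [this]
      exact hd.mul_left (neg_mem hi)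
    · rw [← hr]
      field_simp
  have hr := h.rel n
  rcases chainUnit_eq_or t n with h1 | h1
  · exact key _ hc (by rw [hr, h1, one_mul])
  · refine key (t (n + 2) - t (n + 1) ^ e n) (hc.sub hbe) ?_
    rw [h1] at hr
    linear_combination hr

theorem memMax_succ (h : IsParameterChain k e t) (n : ℕ) :
    (chainRing k t (n + 1)).MemMax (t n) := by
  obtain ⟨κ, hκ, e1⟩ := h.exists_eq_pow_mul n
  rw [e1]
  have := h.pos n
  refine ((h.memMax_left (n + 1)).pow (by lia)).mul_right ?_
  simpa using add_mem hκ.1 (one_mem _)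

theorem le_succ (h : IsParameterChain k e t) (n : ℕ) : chainRing k t n ≤ chainRing k t (n + 1) :=
  origin_le (algebraMap_mem_origin _ _) (h.memMax_succ n) (h.memMax_left (n + 1))

theorem mono (h : IsParameterChain k e t) : Monotone (chainRing k t) :=
  monotone_nat_of_le_succ h.le_succ

end IsParameterChain

/-- The blowup of the origin, at the point of the chart with coordinates `a / b, b` where these
take the values `c, 0`. -/
theorem isQuadraticTransform_origin {a b a' : L} {c : k} (hb0 : b ≠ 0)
    (e : a' = a / b - algebraMap k L c)
    (ha' : (originLocalRing k a' b).MemMax a') (hb : (originLocalRing k a' b).MemMax b) :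
    IsQuadraticTransform (originLocalRing k a b) (originLocalRing k a' b) := by
  have hk := algebraMap_mem_origin (k := k) a' b
  have hdiv : a / b ∈ (originLocalRing k a' b).toSubring := by
    have : a / b = a' + algebraMap k L c := by rw [e]; ring
    rw [this]
    exact add_mem ha'.1 (hk c)
  have ha : (originLocalRing k a' b).MemMax a := by
    have := hb.mul_left hdiv
    rwa [div_mul_cancel₀ _ hb0] at this
  have hle : originLocalRing k a b ≤ originLocalRing k a' b := origin_le hk ha hb
  have hbB := (memMax_iff_of_le hle (right_mem_origin k a b)).2 hb
  have haB := (memMax_iff_of_le hle (left_mem_origin k a b)).2 ha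
  refine isQuadraticTransform_of_le hbB hb0 hle ?_ ?_
  · intro z hz
    obtain ⟨r, hr, s, hs, rfl⟩ := exists_eq_of_memMax_origin haB hbB hz
    have : (a * r + b * s) / b = a / b * r + s := by field_simp
    rw [this]
    exact add_mem (mul_mem hdiv (hle.1 hr)) (hle.1 hs)
  · have hpoly : ∀ f : MvPolynomial (Fin 2) k,
        MvPolynomial.aeval ![a', b] f ∈ blowupChart (originLocalRing k a b) b := by
      refine MvPolynomial.aeval_mem_of_mem (fun c => le_blowupChart _ _ (algebraMap_mem_origin a b c))
        ?_ (le_blowupChart _ _ (right_mem_origin k a b))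
      rw [e]
      exact sub_mem (div_mem_blowupChart haB) (le_blowupChart _ _ (algebraMap_mem_origin a b c))
    rintro _ ⟨f, g, h0, h1, rfl⟩
    exact ⟨_, hpoly f, _, hpoly g, fun h => h0 ((memMax_aeval_iff hk ha' hb g).1 h), rfl⟩

namespace IsParameterChain

variable {e : ℕ → ℕ} {t : ℕ → L} {V : LocalSubring L}

/-- The `e n` quadratic transforms divide `t n` by `t (n + 1)` repeatedly. All but the last one are
centred at the origin of a coordinate chart. The last quotient is a unit with residue `1`, and up to
a change of coordinates the new parameter is this unit minus `1`. -/
theorem reflTransGen_succ (h : IsParameterChain k e t) (n : ℕ) (hV : chainRing k t (n + 1) ≤ V) :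
    Relation.ReflTransGen (fun B B' => IsQuadraticTransform B B' ∧ B' ≤ V)
      (chainRing k t n) (chainRing k t (n + 1)) := by
  obtain ⟨κ, hκ, e1⟩ := h.exists_eq_pow_mul n
  have hb : (chainRing k t (n + 1)).MemMax (t (n + 1)) := h.memMax_left (n + 1)
  have hc : (chainRing k t (n + 1)).MemMax (t (n + 2)) := h.memMax_right (n + 1)
  have hκ' : κ ∈ (chainRing k t (n + 1)).toSubring := by simpa using add_mem hκ.1 (one_mem _)
  have hb0 := h.ne_zero (n + 1)
  have hk := algebraMap_mem_origin (k := k) (t (n + 1)) (t (n + 2))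
  have hdom : ∀ a', (chainRing k t (n + 1)).MemMax a' →
      originLocalRing k a' (t (n + 1)) ≤ chainRing k t (n + 1) := fun a' ha' => origin_le hk ha' hb
  have hstep : ∀ (a a' : L) (c : k), (chainRing k t (n + 1)).MemMax a' →
      a' = a / t (n + 1) - algebraMap k L c →
      IsQuadraticTransform (originLocalRing k a (t (n + 1))) (originLocalRing k a' (t (n + 1))) := by
    intro a a' c ha' e2
    exact isQuadraticTransform_origin hb0 e2
      ((memMax_iff_of_le (hdom a' ha') (left_mem_origin k _ _)).2 ha')
      ((memMax_iff_of_le (hdom a' ha') (right_mem_origin k _ _)).2 hb)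
  have hmem : ∀ i < e n, (chainRing k t (n + 1)).MemMax (t n / t (n + 1) ^ i) := by
    intro i hi
    have : t n / t (n + 1) ^ i = t (n + 1) ^ (e n - i) * κ := by
      rw [e1, div_eq_iff (pow_ne_zero i hb0), mul_right_comm, ← pow_add, Nat.sub_add_cancel hi.le]
    rw [this]
    exact (hb.pow (by lia)).mul_right hκ'
  have hchain : ∀ i < e n, Relation.ReflTransGen (fun B B' => IsQuadraticTransform B B' ∧ B' ≤ V)
      (chainRing k t n) (originLocalRing k (t n / t (n + 1) ^ i) (t (n + 1))) := by
    intro i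
    induction i with
    | zero =>
      intro _
      rw [pow_zero, div_one]
      exact Relation.ReflTransGen.refl
    | succ i ih =>
      intro hi
      refine (ih (by lia)).tail ⟨hstep _ _ 0 (hmem _ hi) ?_, (hdom _ (hmem _ hi)).trans hV⟩
      rw [map_zero, sub_zero, pow_succ, div_div]
  have hpos := h.pos n
  have hlast := hchain (e n - 1) (by lia)
  have e2 : κ - 1 = t n / t (n + 1) ^ (e n - 1) / t (n + 1) - algebraMap k L 1 := by
    rw [div_div, ← pow_succ, Nat.sub_add_cancel (by lia), map_one, e1,
      mul_div_cancel_left₀ _ (pow_ne_zero _ hb0)]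
  have hq := hstep _ _ 1 hκ e2
  have hle := hdom _ hκ
  suffices heq : originLocalRing k (κ - 1) (t (n + 1)) = chainRing k t (n + 1) by
    rw [heq] at hq
    exact hlast.tail ⟨hq, hV⟩
  refine le_antisymm hle (origin_le (algebraMap_mem_origin _ _)
    ((memMax_iff_of_le hle (right_mem_origin k _ _)).2 hb) ?_)
  have hbO := right_mem_origin k (κ - 1) (t (n + 1))
  have hκO : κ ∈ (originLocalRing k (κ - 1) (t (n + 1))).toSubring := by
    simpa using add_mem (left_mem_origin k (κ - 1) (t (n + 1))) (one_mem _)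
  have hκu : ¬ (chainRing k t (n + 1)).MemMax κ := fun hm =>
    not_memMax_one (by simpa using hm.sub hκ)
  obtain ⟨hκ0, hκi⟩ := inv_mem_of_not_memMax hκO (fun hm => hκu (hm.of_le hle))
  have htn : t n ∈ (originLocalRing k (κ - 1) (t (n + 1))).toSubring := by
    rw [e1]
    exact mul_mem (pow_mem hbO _) hκO
  have hεO : chainUnit t n ∈ (originLocalRing k (κ - 1) (t (n + 1))).toSubring := by
    rcases chainUnit_eq_or t n with h1 | h1 <;> rw [h1]
    · exact one_mem _
    · exact add_mem (one_mem _) htn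
  -- `t (n + 2)` is a function of the coordinates `κ - 1, t (n + 1)` of the last blowup
  have e3 : t (n + 2) = chainUnit t n * κ⁻¹ - 1 := by
    have hr := h.rel n
    rw [e1] at hr
    have h4 : t (n + 1) ^ e n ≠ 0 := pow_ne_zero _ hb0
    field_simp
    have : t (n + 1) ^ e n * ((1 + t (n + 2)) * κ - chainUnit t n) = 0 := by
      linear_combination hr
    rcases mul_eq_zero.1 this with h5 | h5
    · exact absurd h5 h4
    · linear_combination h5
  refine (memMax_iff_of_le hle ?_).2 hc
  rw [e3]
  exact sub_mem (mul_mem hεO hκi) (one_mem _)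

end IsParameterChain

end Chains

/-! ### Comparison of two chains of parameters -/

section Comparison

open LocalSubring

variable {L : Type*} [Field L]

/-- The elements of `B` congruent to `1` modulo `τ`. -/
def LocalSubring.congrOne (B : LocalSubring L) (τ : B.toSubring) : Submonoid L where
  carrier := {z | ∃ w ∈ B.toSubring, z = 1 + τ * w}
  mul_mem' := by
    rintro _ _ ⟨w, hw, rfl⟩ ⟨w', hw', rfl⟩
    exact ⟨w + w' + τ * (w * w'), add_mem (add_mem hw hw') (mul_mem τ.2 (mul_mem hw hw')), by ring⟩
  one_mem' := ⟨0, zero_mem _, by simp⟩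

theorem LocalSubring.inv_mem_congrOne {B : LocalSubring L} {τ : B.toSubring} (hτ : B.MemMax (τ : L))
    {z : L} (hz : z ∈ B.congrOne τ) : z ≠ 0 ∧ z⁻¹ ∈ B.congrOne τ := by
  obtain ⟨w, hw, rfl⟩ := hz
  obtain ⟨h0, hi⟩ := inv_mem_of_not_memMax (add_mem (one_mem _) (mul_mem τ.2 hw))
    (not_memMax_one_add (hτ.mul_right hw))
  refine ⟨h0, -w * (1 + τ * w)⁻¹, mul_mem (neg_mem hw) hi, ?_⟩
  field_simp
  ring

variable {k : Type*} [Field k] [Algebra k L]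

/-- The sequence `s` is expressed at `n` by the chain `t` through the exponents `a, b`: the first
parameter `s n` is a unit times `t n ^ a`, and modulo `t n` the second one is a unit times
`t (n + 1) ^ b`. Both units are required to be congruent to `1` modulo the maximal ideal, which is
what makes the property pass from `n` to `n + 1`. -/
def IsPowerForm (k : Type*) [Field k] [Algebra k L] (t s : ℕ → L) (n a b : ℕ) : Prop :=
  ∃ σ lam Λ, (chainRing k t n).MemMax (σ - 1) ∧ (chainRing k t n).MemMax (lam - 1) ∧
    Λ ∈ (chainRing k t n).toSubring ∧ s n = σ * t n ^ a ∧
    s (n + 1) = lam * t (n + 1) ^ b + t n * Λ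

theorem LocalSubring.MemMax.mem_of_sub_one {B : LocalSubring L} {z : L} (h : B.MemMax (z - 1)) :
    z ∈ B.toSubring := by
  simpa using add_mem h.1 (one_mem _)

theorem LocalSubring.MemMax.not_memMax_of_sub_one {B : LocalSubring L} {z : L}
    (h : B.MemMax (z - 1)) : ¬ B.MemMax z := fun hc =>
  not_memMax_one (by simpa using hc.sub h)

variable {e f : ℕ → ℕ} {t s : ℕ → L} {n a b : ℕ}

theorem IsPowerForm.memMax_left (hF : IsPowerForm k t s n a b) (ht : IsParameterChain k e t)
    (ha : a ≠ 0) : (chainRing k t n).MemMax (s n) := by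
  obtain ⟨σ, lam, Λ, hσ, hlam, hΛ, e1, e2⟩ := hF
  rw [e1]
  exact ((ht.memMax_left n).pow ha).mul_left hσ.mem_of_sub_one

theorem IsPowerForm.memMax_right (hF : IsPowerForm k t s n a b) (ht : IsParameterChain k e t)
    (hb : b ≠ 0) : (chainRing k t n).MemMax (s (n + 1)) := by
  obtain ⟨σ, lam, Λ, hσ, hlam, hΛ, e1, e2⟩ := hF
  rw [e2]
  exact (((ht.memMax_right n).pow hb).mul_left hlam.mem_of_sub_one).add
    ((ht.memMax_left n).mul_right hΛ)

theorem IsPowerForm.chainRing_le (hF : IsPowerForm k t s n a b) (ht : IsParameterChain k e t)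
    (ha : a ≠ 0) (hb : b ≠ 0) : chainRing k s n ≤ chainRing k t n :=
  origin_le (algebraMap_mem_origin _ _) (hF.memMax_left ht ha) (hF.memMax_right ht hb)

/-- The maximal ideal of a ring of a chain becomes divisible by its second parameter in the next
ring of the chain. -/
theorem IsParameterChain.exists_eq_mul (ht : IsParameterChain k e t) {z : L}
    (hz : (chainRing k t n).MemMax z) :
    ∃ w ∈ (chainRing k t (n + 1)).toSubring, z = t (n + 1) * w := by
  obtain ⟨r, hr, r', hr', rfl⟩ :=
    exists_eq_of_memMax_origin (ht.memMax_left n) (ht.memMax_right n) hz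
  obtain ⟨κ, hκ, e1⟩ := ht.exists_eq_pow_mul n
  have hle := (ht.le_succ n).1
  have hpos := ht.pos n
  have hτ := (ht.memMax_left (n + 1)).mem
  refine ⟨t (n + 1) ^ (e n - 1) * κ * r + r',
    add_mem (mul_mem (mul_mem (pow_mem hτ _) hκ.mem_of_sub_one) (hle hr)) (hle hr'), ?_⟩
  obtain ⟨m, hm⟩ := Nat.exists_eq_add_of_le (show 1 ≤ e n by lia)
  have : e n - 1 = m := by lia
  rw [this]
  conv_lhs => rw [e1, hm]
  ring

/-- The comparison of two chains propagates, with the two exponents exchanged. The numerical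
condition says that `s (n + 1) ^ f n / s n` and `(t (n + 1) ^ e n / t n) ^ a` agree up to a unit. -/
theorem IsPowerForm.succ {p α : ℕ} [Fact p.Prime] [CharP L p] (ht : IsParameterChain k e t)
    (hs : IsParameterChain k f s) (ha : a = p ^ α) (hab : b * f n = e n * a) (hb : b < e n)
    (hF : IsPowerForm k t s n a b) : IsPowerForm k t s (n + 1) b a := by
  have hsn := hF.memMax_left ht (by rw [ha]; exact pow_ne_zero _ (Fact.out : p.Prime).ne_zero)
  obtain ⟨σ, lam, Λ, hσ, hlam, hΛ, e1, e2⟩ := hF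
  obtain ⟨κ, hκ, e3⟩ := ht.exists_eq_pow_mul n
  have hτ := ht.memMax_left (n + 1)
  set τ : (chainRing k t (n + 1)).toSubring := ⟨t (n + 1), hτ.1⟩ with hτdef
  have hcong : ∀ z, (chainRing k t n).MemMax z → 1 + z ∈ (chainRing k t (n + 1)).congrOne τ := by
    intro z hz
    obtain ⟨w, hw, rfl⟩ := ht.exists_eq_mul hz
    exact ⟨w, hw, rfl⟩
  have hσ' : σ ∈ (chainRing k t (n + 1)).congrOne τ := by simpa using hcong _ hσ
  have hlam' : lam ∈ (chainRing k t (n + 1)).congrOne τ := by simpa using hcong _ hlam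
  have hε : chainUnit t n ∈ (chainRing k t (n + 1)).congrOne τ := by
    rcases chainUnit_eq_or t n with h | h <;> rw [h]
    · exact one_mem _
    · exact hcong _ (ht.memMax_left n)
  have hδ : chainUnit s n ∈ (chainRing k t (n + 1)).congrOne τ := by
    rcases chainUnit_eq_or s n with h | h <;> rw [h]
    · exact one_mem _
    · exact hcong _ hsn
  obtain ⟨m, hm⟩ := Nat.exists_eq_add_of_lt hb
  -- the unit `s (n + 1) / t (n + 1) ^ b`
  have e4 : s (n + 1) = (lam + t (n + 1) ^ (m + 1) * κ * Λ) * t (n + 1) ^ b := by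
    rw [e2, e3, hm]
    ring
  set σ' := lam + t (n + 1) ^ (m + 1) * κ * Λ with hσ'def
  have hσ'1 : σ' ∈ (chainRing k t (n + 1)).congrOne τ := by
    obtain ⟨w, hw, e5⟩ := hlam'
    refine ⟨w + t (n + 1) ^ m * κ * Λ, add_mem hw (mul_mem (mul_mem (pow_mem hτ.1 _)
      hκ.mem_of_sub_one) ((ht.le_succ n).1 hΛ)), ?_⟩
    rw [hσ'def, e5]
    ring
  have hη : chainUnit s n * σ' ^ f n * σ⁻¹ * (chainUnit t n)⁻¹ ^ a ∈
      (chainRing k t (n + 1)).congrOne τ :=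
    mul_mem (mul_mem (mul_mem hδ (pow_mem hσ'1 _)) (inv_mem_congrOne hτ hσ').2)
      (pow_mem (inv_mem_congrOne hτ hε).2 _)
  set η := chainUnit s n * σ' ^ f n * σ⁻¹ * (chainUnit t n)⁻¹ ^ a with hηdef
  -- divide the relation for `s` by the `a`-th power of that for `t`; as `a` is a power of the
  -- characteristic, `(1 + t (n + 2)) ^ a = 1 + t (n + 2) ^ a`
  have e6 : 1 + s (n + 2) = η * (1 + t (n + 2) ^ a) := by
    have h0 : (1 : L) + t (n + 2) ^ a = (1 + t (n + 2)) ^ a := by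
      rw [ha, add_pow_char_pow, one_pow]
    have h1 : ((1 + t (n + 2)) * t n) ^ a = (chainUnit t n * t (n + 1) ^ e n) ^ a := by
      rw [ht.rel n]
    have h2 := hs.rel n
    rw [e1, e4, mul_pow σ', ← pow_mul, hab] at h2
    rw [mul_pow, mul_pow, ← pow_mul] at h1
    have hσ0 := (inv_mem_congrOne hτ hσ').1
    have hε0 := (inv_mem_congrOne hτ hε).1
    have ht0 := pow_ne_zero a (ht.ne_zero n)
    rw [h0, hηdef, inv_pow]
    refine mul_right_cancel₀ (mul_ne_zero hσ0 ht0) ?_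
    rw [h2]
    field_simp
    linear_combination -σ' ^ f n * chainUnit s n * h1
  obtain ⟨w, hw, e7⟩ := hη
  have e7' : η - 1 = t (n + 1) * w := by rw [e7]; ring
  have hσ'' : (chainRing k t (n + 1)).MemMax (σ' - 1) := by
    obtain ⟨w, hw, e5⟩ := hσ'1
    have : σ' - 1 = t (n + 1) * w := by rw [e5]; ring
    rw [this]
    exact hτ.mul_right hw
  refine ⟨σ', η, w, hσ'', e7' ▸ hτ.mul_right hw, hw, e4, ?_⟩
  linear_combination e6 + e7'

end Comparison

/-! ### Finiteness of one chain of local rings over another -/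

section Finiteness

open LocalSubring

variable {L : Type*} [Field L]

/-- `A` is generated as a ring over `R` by finitely many elements that are integral over `R`. -/
def IsFiniteOver (R A : LocalSubring L) : Prop :=
  ∃ S : Set L, S.Finite ∧ (∀ z ∈ S, IsIntegral R.toSubring z) ∧
    ∀ z, z ∈ A.toSubring ↔ z ∈ Algebra.adjoin R.toSubring S

variable {R R' A : LocalSubring L}

theorem IsFiniteOver.le (h : IsFiniteOver R A) : R.toSubring ≤ A.toSubring := by
  obtain ⟨S, -, -, hA⟩ := h
  intro z hz
  exact (hA z).2 ((Algebra.adjoin R.toSubring S).algebraMap_mem ⟨z, hz⟩)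

theorem IsFiniteOver.finite (h : IsFiniteOver R A) : (Subring.inclusion h.le).Finite := by
  obtain ⟨S, hS, hint, hA⟩ := id h
  have hfg : Module.Finite R.toSubring (Algebra.adjoin R.toSubring S) :=
    Module.Finite.iff_fg.2 (fg_adjoin_of_finite hS hint)
  let := (Subring.inclusion h.le).toAlgebra
  let φ : Algebra.adjoin R.toSubring S →ₗ[R.toSubring] A.toSubring :=
    { toFun := fun z => ⟨z, (hA z).2 z.2⟩
      map_add' := fun _ _ => rfl
      map_smul' := fun _ _ => rfl }
  exact Module.Finite.of_surjective φ fun z => ⟨⟨z, (hA z).1 z.2⟩, rfl⟩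

theorem IsFiniteOver.isIntegral (h : IsFiniteOver R A) {z : L} (hz : z ∈ A.toSubring) :
    IsIntegral R.toSubring z := by
  obtain ⟨S, -, hint, hA⟩ := h
  have := Algebra.IsIntegral.adjoin hint
  exact (this.isIntegral ⟨z, (hA z).1 hz⟩).map (Algebra.adjoin R.toSubring S).val

theorem LocalSubring.isIntegral_of_le (h : R.toSubring ≤ R'.toSubring) {z : L}
    (hz : IsIntegral R.toSubring z) : IsIntegral R'.toSubring z :=
  hz.map_of_comp_eq (Subring.inclusion h) (RingHom.id L) rfl

/-- Some `p`-power power of `g` is congruent to an element of the base ring `R` modulo the maximal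
ideal of `R`. If every element of an integral extension of `R` has this property, then the
extension is local. -/
def FrobeniusConstant {R D : Type*} [CommRing R] [IsLocalRing R] [CommRing D] [Algebra R D] (p : ℕ)
    (g : D) : Prop :=
  ∃ (N : ℕ) (r : R), g ^ p ^ N - algebraMap R D r ∈ (maximalIdeal R).map (algebraMap R D)

namespace FrobeniusConstant

variable {R D : Type*} [CommRing R] [IsLocalRing R] [CommRing D] [Algebra R D] {p : ℕ} {g g' : D}

theorem of_base (r : R) : FrobeniusConstant (R := R) p (algebraMap R D r) :=
  ⟨0, r, by simp⟩

theorem of_pow {α : ℕ} (h : FrobeniusConstant (R := R) p (g ^ p ^ α)) :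
    FrobeniusConstant (R := R) p g := by
  obtain ⟨N, r, h⟩ := h
  exact ⟨α + N, r, by rwa [pow_add, pow_mul]⟩

variable [Fact p.Prime]

theorem isUnit [Algebra.IsIntegral R D] (h : FrobeniusConstant (R := R) p g)
    (hg : ∀ (N : ℕ) (r : R), r ∈ maximalIdeal R →
      g ^ p ^ N - algebraMap R D r ∉ (maximalIdeal R).map (algebraMap R D)) :
    IsUnit g := by
  obtain ⟨N, r, h⟩ := h
  by_contra hc
  obtain ⟨M, hM, hgM⟩ := exists_max_ideal_of_mem_nonunits hc
  have hMp := hM.isPrime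
  have hcomap : M.comap (algebraMap R D) = maximalIdeal R :=
    IsLocalRing.eq_maximalIdeal (Ideal.isMaximal_comap_of_isIntegral_of_isMaximal M)
  have hle : (maximalIdeal R).map (algebraMap R D) ≤ M := by
    rw [Ideal.map_le_iff_le_comap, hcomap]
  refine hg N r ?_ h
  rw [← hcomap, Ideal.mem_comap]
  have h1 := sub_mem (Ideal.pow_mem_of_mem M hgM (p ^ N) (pow_pos (Fact.out : p.Prime).pos _))
    (hle h)
  simpa using h1

variable [CharP D p]

theorem sub_pow_mem {N : ℕ} {r : R}
    (h : g ^ p ^ N - algebraMap R D r ∈ (maximalIdeal R).map (algebraMap R D))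
    (M : ℕ) : g ^ p ^ (N + M) - algebraMap R D (r ^ p ^ M) ∈
      (maximalIdeal R).map (algebraMap R D) := by
  have : g ^ p ^ (N + M) - algebraMap R D (r ^ p ^ M) =
      (g ^ p ^ N - algebraMap R D r) ^ p ^ M := by
    rw [sub_pow_char_pow, pow_add, pow_mul, map_pow]
  rw [this]
  exact Ideal.pow_mem_of_mem _ h _ (pow_pos (Fact.out : p.Prime).pos _)

theorem add (h : FrobeniusConstant (R := R) p g) (h' : FrobeniusConstant (R := R) p g') :
    FrobeniusConstant (R := R) p (g + g') := by
  obtain ⟨N, r, h⟩ := h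
  obtain ⟨N', r', h'⟩ := h'
  refine ⟨N + N', r ^ p ^ N' + r' ^ p ^ N, ?_⟩
  have h1 := sub_pow_mem h N'
  have h2 := sub_pow_mem h' N
  rw [add_comm N' N] at h2
  rw [add_pow_char_pow, map_add, add_sub_add_comm]
  exact add_mem h1 h2

theorem mul (h : FrobeniusConstant (R := R) p g) (h' : FrobeniusConstant (R := R) p g') :
    FrobeniusConstant (R := R) p (g * g') := by
  obtain ⟨N, r, h⟩ := h
  obtain ⟨N', r', h'⟩ := h'
  refine ⟨N + N', r ^ p ^ N' * r' ^ p ^ N, ?_⟩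
  have h1 := sub_pow_mem h N'
  have h2 := sub_pow_mem h' N
  rw [add_comm N' N] at h2
  have : (g * g') ^ p ^ (N + N') - algebraMap R D (r ^ p ^ N' * r' ^ p ^ N) =
      g' ^ p ^ (N + N') * (g ^ p ^ (N + N') - algebraMap R D (r ^ p ^ N')) +
      algebraMap R D (r ^ p ^ N') *
        (g' ^ p ^ (N + N') - algebraMap R D (r' ^ p ^ N)) := by
    rw [map_mul, mul_pow]
    ring
  rw [this]
  exact add_mem (Ideal.mul_mem_left _ _ h1) (Ideal.mul_mem_left _ _ h2)

end FrobeniusConstant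

theorem charP_adjoin {p : ℕ} [CharP L p] (S : Set L) : CharP (Algebra.adjoin R.toSubring S) p :=
  (RingHom.charP_iff (Algebra.adjoin R.toSubring S).val.toRingHom Subtype.val_injective p).2
    inferInstance

variable {k : Type*} [Field k] [Algebra k L] {a b : L} {p : ℕ} [Fact p.Prime] [CharP L p]

/-- A criterion for `A = k[a,b]_{(a,b)}` to be a finite extension of `R`. It suffices that `a, b` lie
in the algebra generated by a finite set `S` of integral elements of `A`: by the condition on
`p`-power powers, the elements of this algebra that are units of `A` are invertible in it, so it
contains the denominators as well. -/
theorem isFiniteOver_of_frobeniusConstant (hle : R ≤ A) (hk : ∀ c : k, algebraMap k L c ∈ R.toSubring)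
    (ha : A.MemMax a) (hb : A.MemMax b) (hA : A = originLocalRing k a b) {S : Set L}
    (hS : S.Finite) (hint : ∀ z ∈ S, IsIntegral R.toSubring z) (hSA : ∀ z ∈ S, z ∈ A.toSubring)
    (haS : a ∈ Algebra.adjoin R.toSubring S) (hbS : b ∈ Algebra.adjoin R.toSubring S)
    (hF : ∀ z : Algebra.adjoin R.toSubring S, (z : L) ∈ S →
      FrobeniusConstant (R := R.toSubring) p z) : IsFiniteOver R A := by
  have hchar := charP_adjoin (R := R) (p := p) S
  have hI := Algebra.IsIntegral.adjoin hint
  have hDA : ∀ z ∈ Algebra.adjoin R.toSubring S, z ∈ A.toSubring := by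
    intro z hz
    induction hz using Algebra.adjoin_induction with
    | mem z hz => exact hSA z hz
    | algebraMap r => exact hle.1 r.2
    | add x y _ _ hx hy => exact add_mem hx hy
    | mul x y _ _ hx hy => exact mul_mem hx hy
  have hFall : ∀ z : Algebra.adjoin R.toSubring S, FrobeniusConstant (R := R.toSubring) p z := by
    rintro ⟨z, hz⟩
    induction hz using Algebra.adjoin_induction with
    | mem z hz => exact hF ⟨z, _⟩ hz
    | algebraMap r => exact FrobeniusConstant.of_base r
    | add x y hx' hy' hx hy => exact hx.add hy
    | mul x y hx' hy' hx hy => exact hx.mul hy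
  have hJ : ∀ z ∈ (maximalIdeal R.toSubring).map
      (algebraMap R.toSubring (Algebra.adjoin R.toSubring S)), A.MemMax (z : L) := by
    intro z hz
    refine Submodule.span_induction ?_ memMax_zero (fun x y _ _ hx hy => hx.add hy)
      (fun r x _ hx => hx.mul_left (hDA r r.2)) hz
    rintro _ ⟨r, hr, rfl⟩
    exact (memMax_coe.2 hr).of_le hle
  have hunit : ∀ z : Algebra.adjoin R.toSubring S, ¬ A.MemMax (z : L) →
      (z : L)⁻¹ ∈ Algebra.adjoin R.toSubring S := by
    intro z hz
    have hu : IsUnit z := by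
      refine (hFall z).isUnit fun N r hr hc => ?_
      have h1 : A.MemMax ((z : L) ^ p ^ N) := by
        have h2 := (hJ _ hc).add ((memMax_coe.2 hr).of_le hle)
        change A.MemMax ((z : L) ^ p ^ N - (r : L) + (r : L)) at h2
        rwa [sub_add_cancel] at h2
      by_cases hzA : (z : L) = 0
      · exact hz (hzA ▸ memMax_zero)
      · have hi := (inv_mem_of_not_memMax (hDA z z.2) hz).2
        refine not_memMax_of_inv_mem (pow_ne_zero _ hzA) ?_ h1
        rw [← inv_pow]
        exact pow_mem hi _
    obtain ⟨y, hy⟩ := hu.exists_right_inv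
    have hy' : (z : L) * (y : L) = 1 := congrArg Subtype.val hy
    rw [inv_eq_of_mul_eq_one_right hy']
    exact y.2
  refine ⟨S, hS, hint, fun z => ⟨fun hz => ?_, hDA z⟩⟩
  rw [hA] at hz
  obtain ⟨f, g, h0, h1, rfl⟩ := hz
  have hpoly : ∀ f : MvPolynomial (Fin 2) k, MvPolynomial.aeval ![a, b] f ∈
      (Algebra.adjoin R.toSubring S).toSubring := by
    intro f
    refine MvPolynomial.aeval_mem_of_mem (fun c => ?_) haS hbS f
    exact (Algebra.adjoin R.toSubring S).algebraMap_mem ⟨_, hk c⟩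
  rw [div_eq_mul_inv]
  refine mul_mem (hpoly f) (hunit ⟨_, hpoly g⟩ fun hm => h0 ?_)
  exact (memMax_aeval_iff (fun c => hle.1 (hk c)) ha hb g).1 hm

variable {e f : ℕ → ℕ} {t s : ℕ → L} {n α β γ : ℕ}

theorem algebraMap_mem_chainRing (t : ℕ → L) (n : ℕ) (c : k) :
    algebraMap k L c ∈ (chainRing k t n).toSubring := algebraMap_mem_origin _ _ c

/-- High `p`-power powers of the maximal ideal of the larger ring lie in the ideal generated by the
maximal ideal of the smaller one. -/
theorem IsPowerForm.exists_pow_eq (hF : IsPowerForm k t s n (p ^ α) (p ^ β))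
    (ht : IsParameterChain k e t) {z : L} (hz : (chainRing k t n).MemMax z) :
    ∃ x ∈ (chainRing k t n).toSubring, ∃ y ∈ (chainRing k t n).toSubring,
      z ^ p ^ (β + α) = s n * x + s (n + 1) * y := by
  have hp := (Fact.out : p.Prime).pos
  have hsr := hF.memMax_right ht (pow_pos hp _).ne'
  obtain ⟨σ, lam, Λ, hσ, hlam, hΛ, e1, e2⟩ := hF
  obtain ⟨r, hr, r', hr', rfl⟩ :=
    exists_eq_of_memMax_origin (ht.memMax_left n) (ht.memMax_right n) hz
  obtain ⟨hσ0, hσi⟩ := inv_mem_of_not_memMax hσ.mem_of_sub_one hσ.not_memMax_of_sub_one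
  obtain ⟨hl0, hli⟩ := inv_mem_of_not_memMax hlam.mem_of_sub_one hlam.not_memMax_of_sub_one
  have htn := (ht.memMax_left n).mem
  obtain ⟨i, hi⟩ := Nat.exists_eq_add_of_le (Nat.one_le_pow β p hp)
  obtain ⟨j, hj⟩ := Nat.exists_eq_add_of_le (Nat.one_le_pow α p hp)
  have e3 : t (n + 1) ^ p ^ β = lam⁻¹ * (s (n + 1) - t n * Λ) := by
    rw [e2]; field_simp; ring
  have e4 : t n ^ p ^ α = σ⁻¹ * s n := by
    rw [e1]; field_simp
  set X := t n ^ i * r ^ p ^ β - lam⁻¹ * Λ * r' ^ p ^ β with hX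
  set Y := lam⁻¹ * r' ^ p ^ β with hY
  have hXm : X ∈ (chainRing k t n).toSubring :=
    sub_mem (mul_mem (pow_mem htn _) (pow_mem hr _)) (mul_mem (mul_mem hli hΛ) (pow_mem hr' _))
  have hYm : Y ∈ (chainRing k t n).toSubring := mul_mem hli (pow_mem hr' _)
  have e5 : (t n * r + t (n + 1) * r') ^ p ^ β = t n * X + s (n + 1) * Y := by
    rw [add_pow_char_pow, mul_pow, mul_pow, e3]
    rw [show t n ^ p ^ β = t n * t n ^ i by rw [hi, pow_add, pow_one], hX, hY]
    ring
  refine ⟨σ⁻¹ * X ^ p ^ α, mul_mem hσi (pow_mem hXm _),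
    s (n + 1) ^ j * Y ^ p ^ α, mul_mem (pow_mem hsr.mem _) (pow_mem hYm _), ?_⟩
  rw [pow_add, pow_mul, e5, add_pow_char_pow, mul_pow, mul_pow, e4,
    show s (n + 1) ^ p ^ α = s (n + 1) * s (n + 1) ^ j by rw [hj, pow_add, pow_one]]
  ring

/-- Finiteness passes to the next ring of the chain. The next ring is generated over the smaller one
by the previous ring and the single element `t n / s (n + 1) ^ γ`, whose `p ^ α`-th power is a unit;
the algebra generated by these contains the new parameter by the relation between consecutive
parameters. -/
theorem IsFiniteOver.succ (ht : IsParameterChain k e t) (hs : IsParameterChain k f s)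
    (hF : IsPowerForm k t s n (p ^ α) (p ^ β)) (hF' : IsPowerForm k t s (n + 1) (p ^ β) (p ^ α))
    (hf : f n = p ^ α * γ) (he : e n = p ^ β * γ) (hγ : 1 ≤ γ)
    (h : IsFiniteOver (chainRing k s n) (chainRing k t n)) :
    IsFiniteOver (chainRing k s (n + 1)) (chainRing k t (n + 1)) := by
  have hp := (Fact.out : p.Prime).pos
  have hle : chainRing k s (n + 1) ≤ chainRing k t (n + 1) :=
    hF'.chainRing_le ht (pow_pos hp _).ne' (pow_pos hp _).ne'
  have hsle := hs.le_succ n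
  have htle := ht.le_succ n
  have hpow := fun z (hz : (chainRing k t n).MemMax z) => hF.exists_pow_eq ht hz
  obtain ⟨S, hS, hint, hA⟩ := id h
  obtain ⟨σ, lam, Λ, hσ, hlam, hΛ, e1, e2⟩ := hF
  obtain ⟨σ', -, -, hσ', -, -, e1', -⟩ := hF'
  obtain ⟨κ, hκ, e3⟩ := ht.exists_eq_pow_mul n
  obtain ⟨κ', hκ', e3'⟩ := hs.exists_eq_pow_mul n
  obtain ⟨hσ0, hσi⟩ := inv_mem_of_not_memMax hσ.mem_of_sub_one hσ.not_memMax_of_sub_one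
  obtain ⟨hl0, hli⟩ := inv_mem_of_not_memMax hlam.mem_of_sub_one hlam.not_memMax_of_sub_one
  obtain ⟨hσ'0, hσ'i⟩ := inv_mem_of_not_memMax hσ'.mem_of_sub_one hσ'.not_memMax_of_sub_one
  obtain ⟨hκ'0, hκ'i⟩ := inv_mem_of_not_memMax hκ'.mem_of_sub_one hκ'.not_memMax_of_sub_one
  have hs0 := hs.ne_zero (n + 1)
  have ht0 := ht.ne_zero (n + 1)
  have htn0 := ht.ne_zero n
  set z := t n / s (n + 1) ^ γ with hz
  set D := Algebra.adjoin (chainRing k s (n + 1)).toSubring (insert z S) with hD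
  have hzD : z ∈ D := Algebra.subset_adjoin (Set.mem_insert _ _)
  have hRD : ∀ r ∈ (chainRing k s (n + 1)).toSubring, r ∈ D := fun r hr => D.algebraMap_mem ⟨r, hr⟩
  have hAD : ∀ r ∈ (chainRing k t n).toSubring, r ∈ D := by
    intro r hr
    rw [hA] at hr
    induction hr using Algebra.adjoin_induction with
    | mem r hr => exact Algebra.subset_adjoin (Set.mem_insert_of_mem _ hr)
    | algebraMap r => exact hRD _ (hsle.1 r.2)
    | add x y _ _ hx hy => exact add_mem hx hy
    | mul x y _ _ hx hy => exact mul_mem hx hy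
  have hza : z ^ p ^ α = σ⁻¹ * κ' := by
    rw [hz, div_pow, ← pow_mul, mul_comm γ, ← hf, div_eq_iff (pow_ne_zero _ hs0)]
    have : σ * t n ^ p ^ α = s (n + 1) ^ f n * κ' := by rw [← e1, e3']
    field_simp
    linear_combination this
  have hz0 : z ≠ 0 := div_ne_zero htn0 (pow_ne_zero _ hs0)
  have hziD : z⁻¹ ∈ D := by
    obtain ⟨j, hj⟩ := Nat.exists_eq_add_of_le (Nat.one_le_pow α p hp)
    have : z⁻¹ = z ^ j * (σ * κ'⁻¹) := by
      have h1 : z ^ p ^ α = z * z ^ j := by rw [hj, pow_add, pow_one]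
      rw [hza] at h1
      field_simp
      field_simp at h1
      linear_combination h1
    rw [this]
    exact mul_mem (pow_mem hzD _) (mul_mem (hAD _ hσ.mem_of_sub_one) (hRD _ hκ'i))
  have hsD : s (n + 1) ∈ D := hRD _ (hs.memMax_left (n + 1)).mem
  have htn : t n = s (n + 1) ^ γ * z := by rw [hz, mul_div_cancel₀ _ (pow_ne_zero _ hs0)]
  obtain ⟨γ', hγ'⟩ := Nat.exists_eq_add_of_le hγ
  -- the quotient `t (n + 1) ^ p ^ β / s (n + 1)`
  set ω := lam⁻¹ * (1 - s (n + 1) ^ γ' * z * Λ) with hω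
  have hωD : ω ∈ D := mul_mem (hAD _ hli)
    (sub_mem (one_mem _) (mul_mem (mul_mem (pow_mem hsD _) hzD) (hAD _ hΛ)))
  have e4 : t (n + 1) ^ p ^ β = s (n + 1) * ω := by
    have h1 : lam * t (n + 1) ^ p ^ β = s (n + 1) - s (n + 1) ^ γ * z * Λ := by
      rw [← htn, e2]; ring
    rw [hγ', pow_add, pow_one] at h1
    rw [hω]
    field_simp
    linear_combination h1
  have hεD : chainUnit t n ∈ D := by
    rcases chainUnit_eq_or t n with h1 | h1 <;> rw [h1]
    · exact one_mem _
    · exact add_mem (one_mem _) (hAD _ (ht.memMax_left n).mem)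
  have htD : t (n + 2) ∈ D := by
    have h1 : t (n + 2) = chainUnit t n * ω ^ γ * z⁻¹ - 1 := by
      have h2 := ht.rel n
      rw [he, pow_mul, e4, mul_pow, htn] at h2
      have h3 := pow_ne_zero γ hs0
      field_simp
      refine mul_left_cancel₀ h3 ?_
      linear_combination h2
    rw [h1]
    exact sub_mem (mul_mem (mul_mem hεD (pow_mem hωD _)) hziD) (one_mem _)
  have hint' : ∀ r ∈ (chainRing k t n).toSubring, IsIntegral (chainRing k s (n + 1)).toSubring r :=
    fun r hr => isIntegral_of_le hsle.1 (h.isIntegral hr)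
  refine isFiniteOver_of_frobeniusConstant (k := k) (p := p) (a := t (n + 1)) (b := t (n + 2))
    (S := insert z S) hle (algebraMap_mem_chainRing _ _) (ht.memMax_left _) (ht.memMax_right _) rfl
    (hS.insert z) ?_ ?_ (hAD _ (ht.memMax_right n).mem) htD ?_
  · rintro x (rfl | hx)
    · refine IsIntegral.of_pow (pow_pos hp α) ?_
      rw [hza]
      exact (hint' _ hσi).mul (isIntegral_algebraMap (x :=
        (⟨κ', hκ'.mem_of_sub_one⟩ : (chainRing k s (n + 1)).toSubring)))
    · exact isIntegral_of_le hsle.1 (hint _ hx)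
  · rintro x (rfl | hx)
    · have : z = κ * σ'⁻¹ ^ γ := by
        rw [hz, e3, e1', mul_pow, ← pow_mul, ← he, inv_pow]
        have := pow_ne_zero (e n) ht0
        field_simp
      rw [this]
      exact mul_mem hκ.mem_of_sub_one (pow_mem hσ'i _)
    · exact htle.1 ((hA _).2 (Algebra.subset_adjoin hx))
  · have hchar := charP_adjoin (R := chainRing k s (n + 1)) (p := p) (insert z S)
    -- the elements of the previous ring are constants up to its maximal ideal
    have hFA : ∀ r (hr : r ∈ (chainRing k t n).toSubring),
        FrobeniusConstant (R := (chainRing k s (n + 1)).toSubring) p (⟨r, hAD r hr⟩ : D) := by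
      intro r hr
      obtain ⟨c, hc⟩ := exists_memMax_sub_algebraMap (ht.memMax_left n) (ht.memMax_right n) hr
      obtain ⟨x, hx, y, hy, exy⟩ := hpow _ hc
      refine ⟨β + α, ⟨algebraMap k L c, algebraMap_mem_chainRing _ _ c⟩ ^ p ^ (β + α), ?_⟩
      have h1 : (⟨r, hAD r hr⟩ : D) ^ p ^ (β + α) - algebraMap _ D
          ((⟨algebraMap k L c, algebraMap_mem_chainRing _ _ c⟩ :
            (chainRing k s (n + 1)).toSubring) ^ p ^ (β + α)) =
          algebraMap _ D (⟨s n, (hs.memMax_succ n).1⟩ : (chainRing k s (n + 1)).toSubring) *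
            ⟨x, hAD x hx⟩ +
          algebraMap _ D (⟨s (n + 1), (hs.memMax_left (n + 1)).1⟩ :
            (chainRing k s (n + 1)).toSubring) * ⟨y, hAD y hy⟩ := by
        refine Subtype.ext ?_
        change r ^ p ^ (β + α) - algebraMap k L c ^ p ^ (β + α) = s n * x + s (n + 1) * y
        rw [← exy, sub_pow_char_pow]
      rw [h1]
      exact add_mem (Ideal.mul_mem_right _ _ (Ideal.mem_map_of_mem _ (hs.memMax_succ n).2))
        (Ideal.mul_mem_right _ _ (Ideal.mem_map_of_mem _ (hs.memMax_left (n + 1)).2))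
    rintro ⟨x, hx⟩ (rfl | hx')
    · refine FrobeniusConstant.of_pow (α := α) ?_
      have h1 : (⟨z, hx⟩ : D) ^ p ^ α = ⟨σ⁻¹, hAD _ hσi⟩ *
          algebraMap _ D (⟨κ', hκ'.mem_of_sub_one⟩ : (chainRing k s (n + 1)).toSubring) :=
        Subtype.ext hza
      rw [h1]
      exact (hFA _ hσi).mul (FrobeniusConstant.of_base _)
    · exact hFA x ((hA _).2 (Algebra.subset_adjoin hx'))

end Finiteness

/-! ### The chains of parameters of the example -/

section Recursion

variable {L : Type*} [Field L] {k : Type*} [Field k] [Algebra k L]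

/-- The strict transforms `t n` of a generating sequence `G n` form a chain of parameters. Writing
`t (n + 2) = G (n + 2) / d n`, the recursion for `G` gives `1 + t (n + 2) = G (n + 1) ^ e n / d n`,
and the relation between consecutive parameters follows by cancellation. -/
theorem isParameterChain_of_recursion {G t : ℕ → L} {e m : ℕ → ℕ}
    (hG2 : G 2 = G 1 ^ e 0 - G 0)
    (hG : ∀ n, G (n + 3) = G (n + 2) ^ e (n + 1) - G 0 ^ m n * G (n + 1))
    (ht0 : t 0 = G 0) (ht1 : t 1 = G 1) (ht2 : t 2 = G 2 / G 0)
    (ht : ∀ n, t (n + 3) = G (n + 3) / (G 0 ^ m n * G (n + 1)))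
    (he : ∀ n, e (n + 2) = e n) (hm0 : m 0 = e 1) (hm : ∀ n, m (n + 1) = m n * e (n + 2))
    (he2 : ∀ n, 2 ≤ e n) (hb : IsTranscendenceBasis k ![G 0, G 1]) :
    IsParameterChain k e t ∧ ∀ n, G n ≠ 0 := by
  -- the denominators
  let d : ℕ → L := fun n => Nat.casesOn n (G 0) fun n => G 0 ^ m n * G (n + 1)
  have htd : ∀ n, t (n + 2) = G (n + 2) / d n := by
    rintro (_ | n)
    · exact ht2
    · exact ht n
  have hGd : ∀ n, G (n + 2) = G (n + 1) ^ e n - d n := by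
    rintro (_ | n)
    · exact hG2
    · exact hG n
  have hd : ∀ n, (∀ i ≤ n, G i ≠ 0) → d n ≠ 0 := by
    rintro (_ | n) h
    · exact h 0 le_rfl
    · exact mul_ne_zero (pow_ne_zero _ (h 0 (by lia))) (h _ le_rfl)
  have htd' : ∀ n, (∀ i ≤ n, G i ≠ 0) → 1 + t (n + 2) = G (n + 1) ^ e n / d n := by
    intro n h
    have := hd n h
    rw [htd, hGd]
    field_simp
    ring
  have hrel : ∀ n, (∀ i ≤ n + 1, G i ≠ 0) →
      (1 + t (n + 2)) * t n = chainUnit t n * t (n + 1) ^ e n := by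
    rintro (_ | _ | n) h
    · have h0 := h 0 (by lia)
      rw [htd' 0 fun i hi => h i (by lia), ht0, ht1, chainUnit, if_pos (by lia), one_mul]
      exact div_mul_cancel₀ _ h0
    · have h0 := h 0 (by lia)
      have h1 := h 1 (by lia)
      rw [htd' 1 fun i hi => h i (by lia), ht1, htd 0, chainUnit, if_pos (by lia), one_mul]
      change G 2 ^ e 1 / (G 0 ^ m 0 * G 1) * G 1 = (G 2 / G 0) ^ e 1
      rw [hm0, div_pow]
      have := pow_ne_zero (e 1) h0
      field_simp
    · have h0 := h 0 (by lia)
      have h1 := h (n + 1) (by lia)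
      have h2 := h (n + 2) (by lia)
      rw [htd' (n + 2) fun i hi => h i (by lia), chainUnit, if_neg (by lia),
        htd' n fun i hi => h i (by lia), htd n, htd (n + 1)]
      have h3 := hd n fun i hi => h i (by lia)
      change G (n + 3) ^ e (n + 2) / (G 0 ^ m (n + 1) * G (n + 2)) * (G (n + 2) / d n) =
        G (n + 1) ^ e n / d n * (G (n + 3) / (G 0 ^ m n * G (n + 1))) ^ e (n + 2)
      rw [div_pow, mul_pow, ← pow_mul, ← hm, he]
      have h4 := pow_ne_zero (m (n + 1)) h0
      have h5 := pow_ne_zero (e n) h1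
      field_simp
  have key : ∀ n, IsTranscendenceBasis k ![t n, t (n + 1)] ∧ ∀ i ≤ n + 1, G i ≠ 0 := by
    intro n
    induction n with
    | zero =>
      refine ⟨by rw [ht0, ht1]; exact hb, fun i hi => ?_⟩
      interval_cases i
      · exact hb.1.ne_zero 0
      · exact hb.1.ne_zero 1
    | succ n ih =>
      have h1 := ih.1.pair_of_chain_rel (chainUnit_eq_or t n) (hrel n ih.2)
      refine ⟨h1, fun i hi => ?_⟩
      rcases Nat.lt_or_ge i (n + 2) with hi' | hi'
      · exact ih.2 i (by lia)
      · obtain rfl : i = n + 2 := by lia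
        intro hc
        refine h1.1.ne_zero 1 ?_
        change t (n + 2) = 0
        rw [htd, hc, zero_div]
  exact ⟨⟨fun n => (key n).1, fun n => hrel n (key n).2, he2⟩,
    fun n => (key n).2 n (by lia)⟩

theorem isParameterChain_paramVR {p : ℕ} (hp : 2 ≤ p) {x y : L}
    (h : IsTranscendenceBasis k ![x, y]) :
    IsParameterChain k (fun _ => p ^ 2) (paramVR p x y) ∧ ∀ n, genSeq p x y n ≠ 0 :=
  isParameterChain_of_recursion (m := fun n => p ^ (2 * n + 2)) rfl (fun _ => rfl) rfl rfl rfl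
    (fun _ => rfl) (fun _ => rfl) rfl (fun n => by ring) (fun _ => by nlinarith) h

/-- The exponents of the chain of parameters attached to the sequence `U_j`. -/
def expU (p n : ℕ) : ℕ := if Even n then p else p ^ 3

theorem isParameterChain_paramVA {p : ℕ} (hp : 2 ≤ p) {x v : L}
    (h : IsTranscendenceBasis k ![x, v]) :
    IsParameterChain k (expU p) (paramVA p x v) := by
  have hp3 : 2 ≤ p ^ 3 := hp.trans (Nat.le_self_pow (by lia) p)
  refine (isParameterChain_of_recursion (G := genSeqU p x v) (t := paramVA p x v) (e := expU p)
    (m := fun n => if Odd n then p ^ (2 * n + 2) else p ^ (2 * n + 3))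
    rfl ?_ rfl rfl rfl ?_ ?_ rfl ?_ ?_ h).1
  · intro n
    change (if Odd (n + 2) then _ else _) = _
    by_cases hn : Odd n
    · rw [if_pos (by grind), if_pos hn, expU, if_pos (by grind)]
      rfl
    · rw [if_neg (by grind), if_neg hn, expU, if_neg (by grind)]
      rfl
  · intro n
    change (if Odd (n + 2) then _ else _) = _
    by_cases hn : Odd n
    · rw [if_pos (by grind), if_pos hn]
      rfl
    · rw [if_neg (by grind), if_neg hn]
      rfl
  · intro n
    simp [expU, Nat.even_add]
  · intro n
    by_cases hn : Odd n
    · rw [if_neg (by grind), if_pos hn, expU, if_neg (by grind)]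
      ring
    · rw [if_pos (by grind), if_neg hn, expU, if_pos (by grind)]
      ring
  · intro n
    rw [expU]
    split_ifs <;> assumption

end Recursion

section FunctionField

open LocalSubring

variable (p c : ℕ) (k : Type*) [Field k]

theorem isTranscendenceBasis_xElt_yElt : IsTranscendenceBasis k ![xElt k, yElt k] := by
  have halg : Algebra.IsAlgebraic (MvPolynomial (Fin 2) k) (FunctionField₂ k) :=
    IsFractionRing.comap_isAlgebraic_iff (K := FunctionField₂ k).2 inferInstance
  have h : IsTranscendenceBasis k
      (algebraMap (MvPolynomial (Fin 2) k) (FunctionField₂ k) ∘ MvPolynomial.X) :=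
    (IsTranscendenceBasis.mvPolynomial (Fin 2) k).algebraMap_comp
  convert! h using 1
  ext i
  fin_cases i <;> rfl

theorem xElt_ne_zero : xElt k ≠ 0 := (isTranscendenceBasis_xElt_yElt k).1.ne_zero 0

theorem isTranscendenceBasis_xElt_vElt (hp : 2 ≤ p) :
    IsTranscendenceBasis k ![xElt k, vElt p c k] := by
  have hx : xElt k ∈ Algebra.adjoin k {xElt k, vElt p c k} := Algebra.subset_adjoin (by simp)
  have hv : vElt p c k ∈ Algebra.adjoin k {xElt k, vElt p c k} := Algebra.subset_adjoin (by simp)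
  refine (isTranscendenceBasis_xElt_yElt k).pair_of_isAlgebraic
    (isAlgebraic_algebraMap (⟨_, hx⟩ : Algebra.adjoin k {xElt k, vElt p c k})) ?_
  refine ⟨Polynomial.X ^ p - Polynomial.C ⟨_, pow_mem hx c⟩ * Polynomial.X -
    Polynomial.C ⟨_, hv⟩, fun h0 => ?_, ?_⟩
  · have h1 := congrArg (Polynomial.coeff · p) h0
    obtain ⟨q, rfl⟩ := Nat.exists_eq_add_of_le hp
    simp only [Polynomial.coeff_sub, Polynomial.coeff_X_pow, Polynomial.coeff_C_mul,
      Polynomial.coeff_X, Polynomial.coeff_C, Polynomial.coeff_zero] at h1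
    rw [if_pos trivial, if_neg (by lia), if_neg (by lia)] at h1
    simp at h1
  · simp only [map_sub, map_mul, map_pow, Polynomial.aeval_X, Polynomial.aeval_C]
    change yElt k ^ p - xElt k ^ c * yElt k - (yElt k ^ p - xElt k ^ c * yElt k) = 0
    rw [sub_self]

theorem one_sub_xElt_pow_ne_zero (hp : 2 ≤ p) : 1 - xElt k ^ (p - 1) ≠ 0 := by
  have hx := memMax_of_algebraicIndependent (isTranscendenceBasis_xElt_yElt k).1
  intro h
  have h1 := hx.1.pow (n := p - 1) (by lia)
  rw [← sub_eq_zero.1 h] at h1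
  exact not_memMax_one h1

theorem xElt_pow_eq (hp : 2 ≤ p) :
    xElt k ^ p = uElt p k * (1 - xElt k ^ (p - 1)) := by
  rw [uElt, div_mul_cancel₀ _ (one_sub_xElt_pow_ne_zero p k hp)]

theorem isTranscendenceBasis_uElt_vElt (hp : 2 ≤ p) :
    IsTranscendenceBasis k ![uElt p k, vElt p c k] := by
  have hu : uElt p k ∈ Algebra.adjoin k {uElt p k, vElt p c k} := Algebra.subset_adjoin (by simp)
  have hv : vElt p c k ∈ Algebra.adjoin k {uElt p k, vElt p c k} := Algebra.subset_adjoin (by simp)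
  refine (isTranscendenceBasis_xElt_vElt p c k hp).pair_of_isAlgebraic ?_
    (isAlgebraic_algebraMap (⟨_, hv⟩ : Algebra.adjoin k {uElt p k, vElt p c k}))
  refine ⟨Polynomial.X ^ p + Polynomial.C ⟨_, hu⟩ * Polynomial.X ^ (p - 1) -
    Polynomial.C ⟨_, hu⟩, fun h0 => ?_, ?_⟩
  · have h1 := congrArg (Polynomial.coeff · p) h0
    simp only [Polynomial.coeff_sub, Polynomial.coeff_X_pow, Polynomial.coeff_C_mul,
      Polynomial.coeff_add, Polynomial.coeff_C, Polynomial.coeff_zero] at h1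
    rw [if_pos trivial, if_neg (by lia), if_neg (by lia)] at h1
    simp at h1
  · simp only [map_sub, map_add, map_mul, map_pow, Polynomial.aeval_X, Polynomial.aeval_C]
    change xElt k ^ p + uElt p k * xElt k ^ (p - 1) - uElt p k = 0
    rw [xElt_pow_eq p k hp]
    ring

theorem charP_functionField₂ [CharP k p] : CharP (FunctionField₂ k) p :=
  charP_of_injective_algebraMap (FaithfulSMul.algebraMap_injective k (FunctionField₂ k)) p

variable [Fact p.Prime]

theorem isParameterChain_Q :
    IsParameterChain k (fun _ => p ^ 2) (paramVR p (xElt k) (yElt k)) :=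
  (isParameterChain_paramVR (Fact.out : p.Prime).two_le (isTranscendenceBasis_xElt_yElt k)).1

theorem isParameterChain_A :
    IsParameterChain k (expU p) (paramVA p (xElt k) (vElt p c k)) :=
  isParameterChain_paramVA (Fact.out : p.Prime).two_le
    (isTranscendenceBasis_xElt_vElt p c k (Fact.out : p.Prime).two_le)

theorem isParameterChain_R :
    IsParameterChain k (fun _ => p ^ 2) (paramVR p (uElt p k) (vElt p c k)) :=
  (isParameterChain_paramVR (Fact.out : p.Prime).two_le
    (isTranscendenceBasis_uElt_vElt p c k (Fact.out : p.Prime).two_le)).1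

variable [CharP k p]

theorem isPowerForm_Q_A (hc : 0 < c) (n : ℕ) :
    IsPowerForm k (paramVR p (xElt k) (yElt k)) (paramVA p (xElt k) (vElt p c k)) n
      (p ^ (n % 2)) (p ^ ((n + 1) % 2)) := by
  have := charP_functionField₂ p k
  have hp := (Fact.out : p.Prime).two_le
  induction n with
  | zero =>
    refine ⟨1, 1, -xElt k ^ (c - 1) * yElt k, by simpa using memMax_zero, by simpa using memMax_zero,
      ?_, ?_, ?_⟩
    · exact mul_mem (neg_mem (pow_mem (left_mem_origin k _ _) _)) (right_mem_origin k _ _)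
    · simp [paramVA, paramVR]
    · change vElt p c k = 1 * yElt k ^ p ^ 1 + xElt k * (-xElt k ^ (c - 1) * yElt k)
      obtain ⟨d, rfl⟩ := Nat.exists_eq_add_of_lt hc
      rw [vElt, Nat.add_sub_cancel, pow_one]
      ring
  | succ n ih =>
    have h2 : (n + 1 + 1) % 2 = n % 2 := by lia
    rw [h2]
    refine ih.succ (isParameterChain_Q p k) (isParameterChain_A p c k) rfl ?_ ?_
    · rcases Nat.even_or_odd n with hn | hn
      · have h0 : n % 2 = 0 := by grind
        have h1 : (n + 1) % 2 = 1 := by grind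
        rw [h0, h1, expU, if_pos hn]
        ring
      · have h0 : n % 2 = 1 := by grind
        have h1 : (n + 1) % 2 = 0 := by grind
        rw [h0, h1, expU, if_neg (by grind)]
        ring
    · exact Nat.pow_lt_pow_right (by lia) (by lia)

theorem isPowerForm_A_R (n : ℕ) :
    IsPowerForm k (paramVA p (xElt k) (vElt p c k)) (paramVR p (uElt p k) (vElt p c k)) n
      (p ^ ((n + 1) % 2)) (p ^ (n % 2)) := by
  have := charP_functionField₂ p k
  have hp := (Fact.out : p.Prime).two_le
  induction n with
  | zero =>
    have hx : (chainRing k (paramVA p (xElt k) (vElt p c k)) 0).MemMax (xElt k) :=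
      (isParameterChain_A p c k).memMax_left 0
    have hx' := hx.pow (n := p - 1) (by lia)
    obtain ⟨h0, hi⟩ := inv_mem_of_not_memMax (sub_mem (one_mem _) hx'.1)
      (fun hm => not_memMax_one (by simpa using hm.add hx'))
    refine ⟨(1 - xElt k ^ (p - 1))⁻¹, 1, 0, ?_, by simpa using memMax_zero, zero_mem _, ?_, ?_⟩
    · have : (1 - xElt k ^ (p - 1))⁻¹ - 1 = xElt k ^ (p - 1) * (1 - xElt k ^ (p - 1))⁻¹ := by
        field_simp
        ring
      rw [this]
      exact hx'.mul_right hi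
    · change uElt p k = (1 - xElt k ^ (p - 1))⁻¹ * xElt k ^ p ^ 1
      rw [uElt, pow_one, div_eq_mul_inv, mul_comm]
    · simp [paramVA, paramVR]
  | succ n ih =>
    have h2 : (n + 1 + 1) % 2 = n % 2 := by lia
    rw [h2]
    refine ih.succ (isParameterChain_A p c k) (isParameterChain_R p c k) rfl ?_ ?_
    · rcases Nat.even_or_odd n with hn | hn
      · have h0 : n % 2 = 0 := by grind
        have h1 : (n + 1) % 2 = 1 := by grind
        rw [h0, h1, expU, if_pos hn]
        ring
      · have h0 : n % 2 = 1 := by grind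
        have h1 : (n + 1) % 2 = 0 := by grind
        rw [h0, h1, expU, if_neg (by grind)]
        ring
    · rcases Nat.even_or_odd n with hn | hn
      · have h0 : n % 2 = 0 := by grind
        rw [h0, expU, if_pos hn, pow_zero]
        lia
      · have h0 : n % 2 = 1 := by grind
        rw [h0, expU, if_neg (by grind)]
        exact Nat.pow_lt_pow_right (by lia) (by lia)

theorem chainRing_A_le_Q (hc : 0 < c) (n : ℕ) :
    chainRing k (paramVA p (xElt k) (vElt p c k)) n ≤ chainRing k (paramVR p (xElt k) (yElt k)) n :=
  have hp := (Fact.out : p.Prime).pos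
  (isPowerForm_Q_A p c k hc n).chainRing_le (isParameterChain_Q p k) (pow_pos hp _).ne'
    (pow_pos hp _).ne'

theorem chainRing_R_le_A (n : ℕ) :
    chainRing k (paramVR p (uElt p k) (vElt p c k)) n ≤
      chainRing k (paramVA p (xElt k) (vElt p c k)) n :=
  have hp := (Fact.out : p.Prime).pos
  (isPowerForm_A_R p c k n).chainRing_le (isParameterChain_A p c k) (pow_pos hp _).ne'
    (pow_pos hp _).ne'

theorem isFiniteOver_R_A (n : ℕ) :
    IsFiniteOver (chainRing k (paramVR p (uElt p k) (vElt p c k)) n)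
      (chainRing k (paramVA p (xElt k) (vElt p c k)) n) := by
  have hchar := charP_functionField₂ p k
  have hp := (Fact.out : p.Prime).two_le
  induction n with
  | zero =>
    set R := chainRing k (paramVR p (uElt p k) (vElt p c k)) 0 with hR
    have hu : R.MemMax (uElt p k) := (isParameterChain_R p c k).memMax_left 0
    have hv : R.MemMax (vElt p c k) := (isParameterChain_R p c k).memMax_right 0
    have hxS : xElt k ∈ Algebra.adjoin R.toSubring {xElt k} :=
      Algebra.subset_adjoin (Set.mem_singleton _)
    refine isFiniteOver_of_frobeniusConstant (k := k) (p := p) (S := {xElt k})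
      (chainRing_R_le_A p c k 0) (algebraMap_mem_chainRing _ _)
      ((isParameterChain_A p c k).memMax_left 0) ((isParameterChain_A p c k).memMax_right 0) rfl
      (Set.finite_singleton _) ?_ ?_ hxS ?_ ?_
    · rintro z rfl
      refine ⟨Polynomial.X ^ p + (Polynomial.C (⟨uElt p k, hu.1⟩ : R.toSubring) *
        Polynomial.X ^ (p - 1) - Polynomial.C ⟨uElt p k, hu.1⟩),
        Polynomial.monic_X_pow_add ?_, ?_⟩
      · refine (Polynomial.degree_sub_le _ _).trans_lt (max_lt ?_ ?_)
        · exact (Polynomial.degree_C_mul_X_pow_le _ _).trans_lt (by exact_mod_cast (by lia))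
        · exact Polynomial.degree_C_le.trans_lt (by exact_mod_cast (by lia))
      · simp only [Polynomial.eval₂_add, Polynomial.eval₂_sub, Polynomial.eval₂_mul,
          Polynomial.eval₂_pow, Polynomial.eval₂_X, Polynomial.eval₂_C]
        change xElt k ^ p + (uElt p k * xElt k ^ (p - 1) - uElt p k) = 0
        rw [xElt_pow_eq p k hp]
        ring
    · rintro z rfl
      exact left_mem_origin k _ _
    · exact (Algebra.adjoin R.toSubring {xElt k}).algebraMap_mem ⟨vElt p c k, hv.1⟩
    · rintro ⟨z, hz⟩ (rfl : z = xElt k)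
      refine ⟨1, 0, ?_⟩
      rw [map_zero, sub_zero, pow_one]
      have : (⟨xElt k, hz⟩ : Algebra.adjoin R.toSubring {xElt k}) ^ p =
          algebraMap _ _ (⟨uElt p k, hu.1⟩ : R.toSubring) * (1 - ⟨xElt k, hz⟩ ^ (p - 1)) :=
        Subtype.ext (xElt_pow_eq p k hp)
      rw [this]
      exact Ideal.mul_mem_right _ _ (Ideal.mem_map_of_mem _ hu.2)
  | succ n ih =>
    have hF' := isPowerForm_A_R p c k (n + 1)
    have h2 : (n + 1 + 1) % 2 = n % 2 := by lia
    rw [h2] at hF'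
    rcases Nat.even_or_odd n with hn | hn
    · have h0 : n % 2 = 0 := by grind
      have h1 : (n + 1) % 2 = 1 := by grind
      refine ih.succ (γ := p) (isParameterChain_A p c k) (isParameterChain_R p c k)
        (isPowerForm_A_R p c k n) hF' ?_ ?_ (by lia)
      · rw [h1]; ring
      · rw [h0, expU, if_pos hn]; ring
    · have h0 : n % 2 = 1 := by grind
      have h1 : (n + 1) % 2 = 0 := by grind
      refine ih.succ (γ := p ^ 2) (isParameterChain_A p c k) (isParameterChain_R p c k)
        (isPowerForm_A_R p c k n) hF' ?_ ?_ (Nat.one_le_pow _ _ (by lia))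
      · rw [h1]; ring
      · rw [h0, expU, if_neg (by grind)]; ring

end FunctionField

/-! ### Existence of the valuation -/

section RationalValues

variable {L : Type*} [Field L] {Γ : Type*} [LinearOrderedCommGroupWithZero Γ]

/-- The value of `z`, written additively and normalized by giving `g 0` the weight `1`, is the
rational number `r`. Here `g (n + 1)` is a `q`-th root of `g n`. -/
def HasRationalValue (v : Valuation L Γ) (g : ℕ → Γ) (q : ℕ) (z : L) (r : ℚ) : Prop :=
  ∃ (n : ℕ) (m : ℤ), v z = g n ^ m ∧ r = m / (q : ℚ) ^ n

variable {v : Valuation L Γ} {g : ℕ → Γ} {q : ℕ}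

theorem eq_pow_of_forall_eq_pow (hq : ∀ n, g n = g (n + 1) ^ q) (n m : ℕ) :
    g n = g (n + m) ^ q ^ m := by
  induction m with
  | zero => simp
  | succ m ih => rw [ih, hq (n + m), ← pow_mul, pow_succ']; rfl

namespace HasRationalValue

variable {z w : L} {r s : ℚ}

/-- Two rational values can be written with a common denominator. -/
theorem exists_common (hq : ∀ n, g n = g (n + 1) ^ q) (hq0 : q ≠ 0)
    (hz : HasRationalValue v g q z r) (hw : HasRationalValue v g q w s) :
    ∃ (n : ℕ) (m m' : ℤ), v z = g n ^ m ∧ v w = g n ^ m' ∧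
      r = m / (q : ℚ) ^ n ∧ s = m' / (q : ℚ) ^ n := by
  obtain ⟨n, m, e1, e2⟩ := hz
  obtain ⟨n', m', e1', e2'⟩ := hw
  have hq' : (q : ℚ) ≠ 0 := by exact_mod_cast hq0
  refine ⟨n + n', (q ^ n' : ℕ) * m, (q ^ n : ℕ) * m', ?_, ?_, ?_, ?_⟩
  · rw [e1, eq_pow_of_forall_eq_pow hq n n', zpow_mul, zpow_natCast]
  · rw [e1', eq_pow_of_forall_eq_pow hq n' n, zpow_mul, zpow_natCast, add_comm]
  · rw [e2]
    push_cast
    field_simp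
    ring
  · rw [e2']
    push_cast
    field_simp
    ring

theorem mul (hg0 : ∀ n, 0 < g n) (hq : ∀ n, g n = g (n + 1) ^ q) (hq0 : q ≠ 0)
    (hz : HasRationalValue v g q z r) (hw : HasRationalValue v g q w s) :
    HasRationalValue v g q (z * w) (r + s) := by
  obtain ⟨n, m, m', e1, e2, rfl, rfl⟩ := exists_common hq hq0 hz hw
  refine ⟨n, m + m', by rw [map_mul, e1, e2, zpow_add₀ (hg0 n).ne'], ?_⟩
  push_cast
  ring

theorem le_iff (hg0 : ∀ n, 0 < g n) (hg1 : ∀ n, g n < 1) (hq : ∀ n, g n = g (n + 1) ^ q)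
    (hq0 : q ≠ 0) (hz : HasRationalValue v g q z r) (hw : HasRationalValue v g q w s) :
    v z ≤ v w ↔ s ≤ r := by
  obtain ⟨n, m, m', e1, e2, rfl, rfl⟩ := exists_common hq hq0 hz hw
  have hq' : (0 : ℚ) < (q : ℚ) ^ n := by positivity
  rw [e1, e2, zpow_le_zpow_iff_right_of_lt_one₀ (hg0 n) (hg1 n), div_le_div_iff_of_pos_right hq']
  norm_cast

theorem one : HasRationalValue v g q 1 0 := ⟨0, 0, by simp, by simp⟩

end HasRationalValue

/-- A valuation all of whose values are powers of the elements `g n`, each of which is a `q`-th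
power of the next one, is equivalent to a valuation with rational values. -/
theorem exists_addValuation_of_forall_eq_zpow (hg0 : ∀ n, 0 < g n) (hg1 : ∀ n, g n < 1)
    (hq : ∀ n, g n = g (n + 1) ^ q) (hq0 : q ≠ 0)
    (hv : ∀ z ≠ 0, ∃ (n : ℕ) (m : ℤ), v z = g n ^ m) :
    ∃ ν : AddValuation L (WithTop ℚ), ∀ z ≠ 0, ∀ r, HasRationalValue v g q z r →
      ν z = ((r : ℚ) : WithTop ℚ) := by
  have hex : ∀ z : L, ∃ r, z ≠ 0 → HasRationalValue v g q z r := by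
    intro z
    by_cases h : z = 0
    · exact ⟨0, fun h' => absurd h h'⟩
    · obtain ⟨n, m, e⟩ := hv z h
      exact ⟨_, fun _ => ⟨n, m, e, rfl⟩⟩
  choose φ hφ using hex
  have huniq : ∀ z r s, HasRationalValue v g q z r → HasRationalValue v g q z s → r = s :=
    fun z r s hr hs => le_antisymm ((hs.le_iff hg0 hg1 hq hq0 hr).1 le_rfl)
      ((hr.le_iff hg0 hg1 hq hq0 hs).1 le_rfl)
  classical
  refine ⟨AddValuation.of (fun z => if z = 0 then ⊤ else ((φ z : ℚ) : WithTop ℚ)) (by simp) ?_ ?_ ?_,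
    ?_⟩
  · rw [if_neg one_ne_zero, huniq 1 _ _ (hφ 1 one_ne_zero) HasRationalValue.one]
    rfl
  · intro z w
    change min (if z = 0 then _ else _) (if w = 0 then _ else _) ≤ if z + w = 0 then _ else _
    by_cases hz : z = 0
    · simp [hz]
    by_cases hw : w = 0
    · simp [hw]
    by_cases hzw : z + w = 0
    · simp [hzw]
    rw [if_neg hz, if_neg hw, if_neg hzw]
    rcases le_max_iff.1 (v.map_add z w) with h | h
    · exact min_le_of_left_le
        (by exact_mod_cast ((hφ _ hzw).le_iff hg0 hg1 hq hq0 (hφ z hz)).1 h)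
    · exact min_le_of_right_le
        (by exact_mod_cast ((hφ _ hzw).le_iff hg0 hg1 hq hq0 (hφ w hw)).1 h)
  · intro z w
    change (if z * w = 0 then _ else _) = (if z = 0 then _ else _) + (if w = 0 then _ else _)
    by_cases hz : z = 0
    · simp [hz]
    by_cases hw : w = 0
    · simp [hw]
    rw [if_neg hz, if_neg hw, if_neg (mul_ne_zero hz hw), huniq _ _ _ (hφ _ (mul_ne_zero hz hw))
      ((hφ z hz).mul hg0 hq hq0 (hφ w hw))]
    rfl
  · intro z hz r hr
    change (if z = 0 then _ else _) = _
    rw [if_neg hz, huniq z _ _ (hφ z hz) hr]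

end RationalValues

section BetaBar

variable {p : ℕ}

theorem betaBar_add_two (hp : p ≠ 0) (n : ℕ) :
    betaBar p (n + 2) = (p : ℚ) ^ 2 * betaBar p (n + 1) + 1 / ((p : ℚ) ^ 2) ^ (n + 2) := by
  have hp' : (p : ℚ) ≠ 0 := by exact_mod_cast hp
  induction n with
  | zero => simp only [betaBar]; field_simp; ring
  | succ n ih =>
    rw [betaBar]
    conv_lhs => rw [ih]
    rw [show n + 1 + 1 = n + 2 from rfl, betaBar]
    field_simp
    ring

/-- The value of `Q_{n+3} / (x ^ p ^ (2n+2) * Q_{n+1})` is `p ^ (-2(n+3))`. -/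
theorem betaBar_add_three (hp : p ≠ 0) (n : ℕ) :
    betaBar p (n + 3) =
      1 / ((p : ℚ) ^ 2) ^ (n + 3) + (p : ℚ) ^ (2 * n + 2) + betaBar p (n + 1) := by
  have hp' : (p : ℚ) ≠ 0 := by exact_mod_cast hp
  rw [betaBar_add_two hp (n + 1), show n + 1 + 1 = n + 2 from rfl, betaBar]
  field_simp
  ring

end BetaBar

section Expansion

open Polynomial

variable {L : Type*} [Field L] {k : Type*} [Field k] [Algebra k L]

/-- The sequence `Q_{n+1}` as polynomials in `y` over `k[x]`. -/
noncomputable def genPoly (p : ℕ) (k : Type*) [Field k] : ℕ → k[X][X]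
  | 0 => X
  | 1 => X ^ p ^ 2 - C X
  | n + 2 => genPoly p k (n + 1) ^ p ^ 2 - C X ^ p ^ (2 * n + 2) * genPoly p k n

theorem genPoly_monic {p : ℕ} (hp : 2 ≤ p) (n : ℕ) :
    (genPoly p k n).Monic ∧ (genPoly p k n).natDegree = (p ^ 2) ^ n := by
  have hp2 : 2 ≤ p ^ 2 := by nlinarith
  have key : ∀ {f h : k[X][X]} {d : ℕ}, f.Monic → f.natDegree = d → h.natDegree < d →
      (f - h).Monic ∧ (f - h).natDegree = d := by
    intro f h d hf hd hh
    have hlt : h.degree < f.degree := by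
      rw [degree_eq_natDegree hf.ne_zero, hd]
      exact (degree_le_natDegree).trans_lt (by exact_mod_cast hh)
    refine ⟨hf.sub_of_left hlt, ?_⟩
    rw [natDegree_sub_eq_left_of_natDegree_lt (by lia), hd]
  induction n using Nat.twoStepInduction with
  | zero => exact ⟨monic_X, by simp [genPoly]⟩
  | one =>
    refine key (monic_X_pow _) (by simp) ?_
    rw [natDegree_C]
    positivity
  | more n ih ih' =>
    refine key (ih'.1.pow _) ?_ ?_
    · rw [ih'.1.natDegree_pow, ih'.2, pow_succ' _ (n + 1)]
    · refine natDegree_mul_le.trans_lt ?_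
      rw [← C_pow, natDegree_C, zero_add, ih.2]
      exact Nat.pow_lt_pow_right (by lia) (by lia)

/-- Evaluation of polynomials in two variables at `x, y`. -/
noncomputable def evalPair (k : Type*) [Field k] [Algebra k L] (x y : L) : k[X][X] →+* L :=
  eval₂RingHom (eval₂RingHom (algebraMap k L) x) y

theorem evalPair_genPoly (p : ℕ) (x y : L) (n : ℕ) :
    evalPair k x y (genPoly p k n) = genSeq p x y (n + 1) := by
  induction n using Nat.twoStepInduction with
  | zero => simp [genPoly, evalPair, genSeq]
  | one => simp [genPoly, evalPair, genSeq]
  | more n ih ih' =>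
    rw [genPoly, map_sub, map_mul, map_pow, map_pow, ih, ih', genSeq]
    simp [evalPair]

variable {Γ : Type*} [LinearOrderedCommGroupWithZero Γ] {v : Valuation L Γ} {g : ℕ → Γ} {q : ℕ}

/-- A valuation with `v Q_{n+1} = g (n + 1) ^ N`, with `N` congruent to `1` modulo `q`, takes values
among the powers of `g n` on the polynomials of degree less than `q ^ n` in `y`.
One expands in powers of `Q_{n+1}`: the terms of the expansion have different values, as these
lie in different cosets of the powers of `g n`. -/
theorem exists_eq_pow_of_natDegree_lt {x y : L} {G : ℕ → k[X][X]} (hk : ∀ c : k, c ≠ 0 →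
      v (algebraMap k L c) = 1)
    (hg0 : ∀ n, 0 < g n) (hg1 : ∀ n, g n < 1) (hq : ∀ n, g n = g (n + 1) ^ q)
    (hx : v x = g 0) (hG : ∀ n, (G n).Monic ∧ (G n).natDegree = q ^ n)
    (hGv : ∀ n, ∃ N, v (evalPair k x y (G n)) = g (n + 1) ^ N ∧ N % q = 1)
    (n : ℕ) {f : k[X][X]} (hf0 : f ≠ 0) (hf : f.natDegree < q ^ n) :
    ∃ m : ℕ, v (evalPair k x y f) = g n ^ m := by
  induction n generalizing f with
  | zero =>
    rw [pow_zero, Nat.lt_one_iff] at hf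
    obtain ⟨h, rfl⟩ : ∃ h, f = C h := ⟨_, eq_C_of_natDegree_eq_zero hf⟩
    have hh : h ≠ 0 := by rintro rfl; simp at hf0
    obtain ⟨h', e, hdvd⟩ := exists_eq_pow_rootMultiplicity_mul_and_not_dvd h hh 0
    rw [map_zero, sub_zero] at e hdvd
    refine ⟨h.rootMultiplicity 0, ?_⟩
    have hint : ∀ h : k[X], v (eval₂ (algebraMap k L) x h) ≤ 1 := by
      intro h
      induction h using Polynomial.induction_on' with
      | add f f' hf hf' => rw [eval₂_add]; exact v.map_add_le hf hf'
      | monomial n a =>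
        rw [eval₂_monomial, map_mul, map_pow, hx]
        refine mul_le_one' ?_ (pow_le_one₀ (hg0 0).le (hg1 0).le)
        by_cases ha : a = 0
        · simp [ha]
        · exact (hk a ha).le
    have hunit : v (eval₂ (algebraMap k L) x h') = 1 := by
      have h0 : h'.coeff 0 ≠ 0 := fun h0 => hdvd (X_dvd_iff.2 h0)
      rw [← divX_mul_X_add h', eval₂_add, eval₂_mul, eval₂_X, eval₂_C]
      rw [v.map_add_eq_of_lt_right, hk _ h0]
      rw [hk _ h0, map_mul, hx]
      exact (mul_le_of_le_one_left' (hint _)).trans_lt (hg1 0)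
    change v (eval₂ _ y (C h)) = _
    rw [eval₂_C, e]
    change v (eval₂ _ x _) = _
    rw [eval₂_mul, eval₂_pow, eval₂_X, map_mul, map_pow, hunit, mul_one, hx, ← e]
  | succ n ih =>
    obtain ⟨hmon, hdeg⟩ := hG n
    obtain ⟨N, hN, hNq⟩ := hGv n
    have hqpos : 0 < q := by
      rcases Nat.eq_zero_or_pos q with h | h
      · rw [h, pow_succ, mul_zero] at hf
        exact absurd hf (by lia)
      · exact h
    have hinj : ∀ a b : ℕ, g (n + 1) ^ a = g (n + 1) ^ b → a = b := fun a b h =>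
      pow_right_injective₀ (hg0 _) (hg1 _).ne h
    have key : ∀ i ≤ q, ∀ f : k[X][X], f ≠ 0 → f.natDegree < i * q ^ n →
        ∃ l < i, ∃ m : ℕ, v (evalPair k x y f) = g (n + 1) ^ (q * m + N * l) := by
      intro i
      induction i with
      | zero => intro _ f _ hf; rw [zero_mul] at hf; exact absurd hf (by lia)
      | succ i ihi =>
        intro hi f hf0 hf
        have hdiv := modByMonic_add_div f (G n)
        have hmod : f %ₘ G n ≠ 0 → ∃ m : ℕ, v (evalPair k x y (f %ₘ G n)) = g (n + 1) ^ (q * m) := by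
          intro h0
          obtain ⟨m, hm⟩ := ih h0 (by
            rw [← hdeg]
            refine natDegree_modByMonic_lt f hmon fun h1 => ?_
            rw [h1, natDegree_one] at hdeg
            exact (pow_pos hqpos n).ne hdeg)
          exact ⟨m, by rw [hm, hq n, ← pow_mul]⟩
        by_cases hd0 : f /ₘ G n = 0
        · rw [hd0, mul_zero, add_zero] at hdiv
          rw [hdiv] at hmod
          obtain ⟨m, hm⟩ := hmod hf0
          exact ⟨0, by lia, m, by rw [hm, mul_zero, add_zero]⟩
        · have hdd : (f /ₘ G n).natDegree < i * q ^ n := by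
            have h1 := natDegree_divByMonic f hmon
            have h2 : (G n).natDegree ≤ f.natDegree := by
              by_contra hc
              exact hd0 ((divByMonic_eq_zero_iff hmon).2 (degree_lt_degree (not_le.1 hc)))
            rw [hdeg] at h1 h2
            rw [add_mul, one_mul] at hf
            lia
          obtain ⟨l, hl, m, hm⟩ := ihi (by lia) _ hd0 hdd
          have hprod : v (evalPair k x y (G n * (f /ₘ G n))) =
              g (n + 1) ^ (q * m + N * (l + 1)) := by
            rw [map_mul, map_mul, hN, hm, ← pow_add]
            ring_nf
          by_cases hr0 : f %ₘ G n = 0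
          · rw [hr0, zero_add] at hdiv
            exact ⟨l + 1, by lia, m, by rw [← hdiv, hprod]⟩
          · obtain ⟨m', hm'⟩ := hmod hr0
            have hne : v (evalPair k x y (f %ₘ G n)) ≠
                v (evalPair k x y (G n * (f /ₘ G n))) := by
              rw [hprod, hm']
              intro h
              have h1 := congrArg (· % q) (hinj _ _ h)
              simp only [Nat.mul_mod_right, Nat.mul_add_mod] at h1
              have h2 : (N * (l + 1)) % q = (l + 1) % q := by
                rw [Nat.mul_mod, hNq, one_mul, Nat.mod_mod]
              rw [h2, Nat.mod_eq_of_lt (by lia)] at h1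
              lia
            have hsum := v.map_add_of_distinct_val hne
            rw [← map_add, hdiv] at hsum
            rcases max_choice (v (evalPair k x y (f %ₘ G n)))
              (v (evalPair k x y (G n * (f /ₘ G n)))) with h | h
            · exact ⟨0, by lia, m', by rw [hsum, h, hm', mul_zero, add_zero]⟩
            · exact ⟨l + 1, by lia, m, by rw [hsum, h, hprod]⟩
    obtain ⟨l, -, m, hm⟩ := key q le_rfl f hf0 (by rwa [← pow_succ'])
    exact ⟨_, hm⟩

end Expansion

section Existence

open LocalSubring

variable {L : Type*} [Field L]

/-- The union of an increasing sequence of local rings, each dominated by the next, is dominated by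
a valuation ring. -/
theorem exists_valuationSubring_of_monotone {B : ℕ → LocalSubring L} (hB : Monotone B) :
    ∃ V : ValuationSubring L, ∀ n, B n ≤ V.toLocalSubring := by
  have hB' : ∀ {m n}, m ≤ n → (B m).toSubring ≤ (B n).toSubring := fun h => (hB h).1
  let S : Subring L :=
    { carrier := {z | ∃ n, z ∈ (B n).toSubring}
      mul_mem' := by
        rintro a b ⟨m, hm⟩ ⟨n, hn⟩
        exact ⟨max m n, mul_mem (hB' (le_max_left _ _) hm) (hB' (le_max_right _ _) hn)⟩
      one_mem' := ⟨0, one_mem _⟩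
      add_mem' := by
        rintro a b ⟨m, hm⟩ ⟨n, hn⟩
        exact ⟨max m n, add_mem (hB' (le_max_left _ _) hm) (hB' (le_max_right _ _) hn)⟩
      zero_mem' := ⟨0, zero_mem _⟩
      neg_mem' := by
        rintro a ⟨m, hm⟩
        exact ⟨m, neg_mem hm⟩ }
  have hBS : ∀ n, (B n).toSubring ≤ S := fun n z hz => ⟨n, hz⟩
  have hS : IsLocalRing S := by
    refine IsLocalRing.of_isUnit_or_isUnit_one_sub_self ?_
    rintro ⟨z, n, hz⟩
    rcases IsLocalRing.isUnit_or_isUnit_one_sub_self (⟨z, hz⟩ : (B n).toSubring) with h | h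
    · exact Or.inl (h.map (Subring.inclusion (hBS n)))
    · exact Or.inr (h.map (Subring.inclusion (hBS n)))
  obtain ⟨V, hV⟩ := (LocalSubring.mk S).exists_le_valuationSubring
  refine ⟨V, fun n => le_trans (le_of_memMax (hBS n) fun z hz => ?_) hV⟩
  by_contra hc
  obtain ⟨h0, m, hm⟩ := inv_mem_of_not_memMax (B := LocalSubring.mk S) (hBS n hz.1) hc
  refine not_memMax_of_inv_mem (B := B (max m n)) h0 (hB' (le_max_left _ _) hm) ?_
  exact hz.of_le (hB (le_max_right _ _))

theorem ValuationSubring.valuation_lt_one_of_memMax {V : ValuationSubring L} {z : L}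
    (hz : V.toLocalSubring.MemMax z) : V.valuation z < 1 :=
  (V.valuation_lt_one_iff ⟨z, hz.1⟩).1 hz.2

theorem ValuationSubring.valuation_eq_one_of_not_memMax {V : ValuationSubring L} {z : L}
    (hz : z ∈ V) (hz' : ¬ V.toLocalSubring.MemMax z) : V.valuation z = 1 :=
  (V.valuation_eq_one_iff ⟨z, hz⟩).1
    (isUnit_iff_not_memMax (B := V.toLocalSubring) (z := ⟨z, hz⟩).2 hz')

variable (p : ℕ) (k : Type*) [Field k]

theorem genSeq_two_eq :
    genSeq p (xElt k) (yElt k) 2 = paramVR p (xElt k) (yElt k) 2 * xElt k :=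
  (div_mul_cancel₀ _ (xElt_ne_zero k)).symm

variable [Fact p.Prime]

theorem genSeq_ne_zero (n : ℕ) : genSeq p (xElt k) (yElt k) n ≠ 0 :=
  (isParameterChain_paramVR (Fact.out : p.Prime).two_le (isTranscendenceBasis_xElt_yElt k)).2 n

theorem genSeq_add_three_eq (n : ℕ) :
    genSeq p (xElt k) (yElt k) (n + 3) = paramVR p (xElt k) (yElt k) (n + 3) *
      (xElt k ^ p ^ (2 * n + 2) * genSeq p (xElt k) (yElt k) (n + 1)) :=
  (div_mul_cancel₀ _ (mul_ne_zero (pow_ne_zero _ (xElt_ne_zero k)) (genSeq_ne_zero p k _))).symm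

/-- The valuation is obtained from a valuation ring dominating all local rings of the chain of
parameters `Q_{j+1} / (x ^ p ^ (2j-2) * Q_{j-1})`. Domination determines the values of the
parameters up to normalization, and the expansion of polynomials in the `Q_j` shows that there are
no other values than those generated by them. -/
theorem exists_isNuStar : ∃ ν : AddValuation (FunctionField₂ k) (WithTop ℚ), IsNuStar p k ν := by
  have hp := (Fact.out : p.Prime).two_le
  have hch := isParameterChain_Q p k
  set x := xElt k with hx
  set y := yElt k with hy
  set t := paramVR p x y with ht
  obtain ⟨V, hV⟩ := exists_valuationSubring_of_monotone hch.mono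
  set v := V.valuation with hv
  have hone : ∀ n, ∀ z, z ∈ (chainRing k t n).toSubring → ¬ (chainRing k t n).MemMax z → v z = 1 := by
    intro n z hz hz'
    exact ValuationSubring.valuation_eq_one_of_not_memMax ((hV n).1 hz)
      fun hm => hz' ((memMax_iff_of_le (hV n) hz).2 hm)
  have hk : ∀ c : k, c ≠ 0 → v (algebraMap k (FunctionField₂ k) c) = 1 := fun c hc =>
    hone 0 _ (algebraMap_mem_chainRing _ _ c)
      (not_memMax_algebraMap (algebraMap_mem_chainRing t 0) hc)
  have hadd : ∀ n, v (1 + t n) = 1 := fun n =>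
    hone n _ (add_mem (one_mem _) (hch.memMax_left n).1) (not_memMax_one_add (hch.memMax_left n))
  have hunit : ∀ n, v (chainUnit t n) = 1 := by
    intro n
    rcases chainUnit_eq_or t n with h | h <;> rw [h]
    · exact map_one v
    · exact hadd n
  let g : ℕ → V.ValueGroup := fun n => v (t n)
  have hg0 : ∀ n, 0 < g n := fun n => zero_lt_iff.2 ((map_ne_zero v).2 (hch.ne_zero n))
  have hg1 : ∀ n, g n < 1 := fun n =>
    ValuationSubring.valuation_lt_one_of_memMax ((hch.memMax_left n).of_le (hV n))
  have hq : ∀ n, g n = g (n + 1) ^ (p ^ 2) := by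
    intro n
    have h := congrArg v (hch.rel n)
    rwa [map_mul, map_mul, hadd, hunit, one_mul, one_mul, map_pow] at h
  have hq0 : p ^ 2 ≠ 0 := by positivity
  have hp0 : p ≠ 0 := by lia
  -- the values of the `Q_j`, with the exponents modulo `p ^ 2`
  have hQ : ∀ n, (∃ N, v (genSeq p x y (n + 1)) = g (n + 1) ^ N ∧ N % p ^ 2 = 1) ∧
      HasRationalValue v g (p ^ 2) (genSeq p x y (n + 1)) (betaBar p (n + 1)) := by
    have hp2 : 1 % p ^ 2 = 1 := Nat.mod_eq_of_lt (by nlinarith)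
    have hxpow : ∀ m n, v (x ^ m) = g n ^ (p ^ 2 * ((p ^ 2) ^ (n - 1) * m)) ∨ n = 0 := by
      intro m n
      rcases n with _ | n
      · exact Or.inr rfl
      · left
        rw [map_pow, show v x = g 0 from rfl, eq_pow_of_forall_eq_pow hq 0 (n + 1), zero_add,
          ← pow_mul, Nat.add_sub_cancel]
        ring_nf
    have hxr : ∀ m : ℕ, HasRationalValue v g (p ^ 2) (x ^ m) m := fun m =>
      ⟨0, m, by rw [map_pow, zpow_natCast]; rfl, by simp⟩
    have htr : ∀ n : ℕ, HasRationalValue v g (p ^ 2) (t n) (1 / ((p : ℚ) ^ 2) ^ n) := fun n =>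
      ⟨n, 1, by rw [zpow_one], by push_cast; rfl⟩
    intro n
    induction n using Nat.twoStepInduction with
    | zero =>
      refine ⟨⟨1, by rw [pow_one]; rfl, hp2⟩, ?_⟩
      have := htr 1
      rw [pow_one] at this
      exact this
    | one =>
      constructor
      · refine ⟨p ^ 2 * ((p ^ 2) ^ (2 - 1) * 1) + 1, ?_, by rw [Nat.mul_add_mod, hp2]⟩
        rw [genSeq_two_eq, map_mul, pow_succ, mul_comm, ← (hxpow 1 2).resolve_right (by lia), pow_one]
      · have h1 := (htr 2).mul hg0 hq hq0 (hxr 1)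
        rw [pow_one] at h1
        rw [genSeq_two_eq]
        convert! h1 using 1
        rw [betaBar_add_two hp0 0, betaBar]
        push_cast
        field_simp
        ring
    | more n ih ih' =>
      obtain ⟨⟨N, hN, -⟩, hr⟩ := ih
      constructor
      · refine ⟨p ^ 2 * ((p ^ 2) ^ (n + 3 - 1) * p ^ (2 * n + 2)) + (p ^ 2 * (p ^ 2 * N) + 1), ?_, by
          rw [Nat.mul_add_mod, Nat.mul_add_mod, hp2]⟩
        have h2 : v (genSeq p x y (n + 1)) = g (n + 3) ^ (p ^ 2 * (p ^ 2 * N)) := by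
          rw [hN, hq (n + 1), hq (n + 1 + 1), ← pow_mul, ← pow_mul]
        rw [genSeq_add_three_eq, map_mul, map_mul, (hxpow _ (n + 3)).resolve_right (by lia), h2,
          ← pow_add, ← add_assoc, pow_add _ _ 1, pow_one]
        exact mul_comm _ _
      · have h1 := (htr (n + 3)).mul hg0 hq hq0 ((hxr (p ^ (2 * n + 2))).mul hg0 hq hq0 hr)
        rw [genSeq_add_three_eq]
        convert! h1 using 1
        rw [betaBar_add_three hp0]
        push_cast
        ring
  have hφ : ∀ f : Polynomial (Polynomial k), f ≠ 0 →
      ∃ (n : ℕ) (m : ℕ), v (evalPair k x y f) = g n ^ m := by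
    intro f hf
    have hn : f.natDegree < (p ^ 2) ^ f.natDegree := Nat.lt_pow_self (by nlinarith)
    exact ⟨f.natDegree, exists_eq_pow_of_natDegree_lt hk hg0 hg1 hq rfl (genPoly_monic hp)
      (fun n => by rw [evalPair_genPoly]; exact (hQ n).1) _ hf hn⟩
  have hrange : ∀ f : MvPolynomial (Fin 2) k,
      algebraMap (MvPolynomial (Fin 2) k) (FunctionField₂ k) f ∈ (evalPair k x y).range := by
    intro f
    have h1 : algebraMap (MvPolynomial (Fin 2) k) (FunctionField₂ k) f =
        MvPolynomial.aeval ![x, y] f := by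
      have : (Algebra.ofId (MvPolynomial (Fin 2) k) (FunctionField₂ k)).restrictScalars k =
          MvPolynomial.aeval ![x, y] := by
        refine MvPolynomial.algHom_ext fun i => ?_
        rw [MvPolynomial.aeval_X]
        fin_cases i <;> rfl
      exact congrArg (fun φ => φ f) this
    rw [h1]
    refine MvPolynomial.aeval_mem_of_mem (S := (evalPair k x y).range) (fun c => ⟨Polynomial.C (Polynomial.C c), ?_⟩)
      ⟨Polynomial.C Polynomial.X, ?_⟩ ⟨Polynomial.X, ?_⟩ f <;> simp [evalPair]
  have hval : ∀ z : FunctionField₂ k, z ≠ 0 → ∃ (n : ℕ) (m : ℤ), v z = g n ^ m := by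
    intro z hz
    obtain ⟨a, b, hb, rfl⟩ := IsFractionRing.div_surjective (A := MvPolynomial (Fin 2) k) z
    obtain ⟨a', ha'⟩ := hrange a
    obtain ⟨b', hb'⟩ := hrange b
    rw [← ha', ← hb'] at hz ⊢
    have ha0 : a' ≠ 0 := by rintro rfl; simp at hz
    have hb0 : b' ≠ 0 := by rintro rfl; simp at hz
    obtain ⟨n, m, e⟩ := hφ a' ha0
    obtain ⟨n', m', e'⟩ := hφ b' hb0
    refine ⟨n + n', ((p ^ 2) ^ n' * m : ℕ) - ((p ^ 2) ^ n * m' : ℕ), ?_⟩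
    rw [map_div₀, e, e', zpow_sub₀ (hg0 _).ne', zpow_natCast, zpow_natCast, pow_mul, pow_mul,
      ← eq_pow_of_forall_eq_pow hq n n', add_comm, ← eq_pow_of_forall_eq_pow hq n' n]
  obtain ⟨ν, hν⟩ := exists_addValuation_of_forall_eq_zpow hg0 hg1 hq hq0 hval
  refine ⟨ν, fun c hc => ?_, fun j => ?_⟩
  · refine hν _ (by simpa using hc) 0 ⟨0, 0, by rw [hk c hc, zpow_zero], by simp⟩
  · rcases j with _ | j
    · exact hν _ (genSeq_ne_zero p k 0) _ ⟨0, 1, by rw [zpow_one]; rfl, by simp [betaBar]⟩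
    · exact hν _ (genSeq_ne_zero p k _) _ (hQ j).2

end Existence

/-! ### The sequences of quadratic transforms -/

section Transforms

open LocalSubring

variable {L : Type*} [Field L]

theorem AddValuation.pos_of_lt {ν : AddValuation L (WithTop ℚ)} {z w : L} {r s : ℚ}
    (hzw : ν (z * w) = (s : WithTop ℚ)) (hw : ν w = (r : WithTop ℚ)) (h : r < s) : 0 < ν z := by
  by_contra hc
  have h1 : ν (z * w) ≤ 0 + (r : WithTop ℚ) := by
    rw [AddValuation.map_mul, hw]
    gcongr
    exact not_lt.1 hc
  rw [hzw, zero_add, WithTop.coe_le_coe] at h1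
  exact h1.not_gt h

theorem isTransformSequence_chainRing {k : Type*} [Field k] [Algebra k L] {e : ℕ → ℕ}
    {s t : ℕ → L} {a b : L} {ν : AddValuation L (WithTop ℚ)} (ht : IsParameterChain k e t)
    (hν : ∀ n, chainRing k t n ≤ ν.localSubring) (ha : t 0 = a) (hb : t 1 = b)
    (hs : ∀ n, s (n + 1) = t n) :
    IsTransformSequence ν (originLocalRing k a b) s t (fun j => chainRing k t (j - 1)) := by
  subst ha hb
  refine ⟨rfl, fun j hj => ?_, fun j hj => ?_⟩
  · obtain ⟨n, rfl⟩ := Nat.exists_eq_add_of_le' hj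
    exact Relation.ReflTransGen.mono (fun _ _ h => isQuadraticTransformAlong_iff.2 h)
      _ _ (ht.reflTransGen_succ n (hν (n + 1)))
  · obtain ⟨n, rfl⟩ := Nat.exists_eq_add_of_le' hj
    rw [hs]
    exact isRegularParameters_origin (ht.indep n)

variable {p c : ℕ} {k : Type*} [Field k] {ν : AddValuation (FunctionField₂ k) (WithTop ℚ)}

theorem IsNuStar.xElt_pow (h : IsNuStar p k ν) (m : ℕ) :
    ν (xElt k ^ m) = ((m : ℚ) : WithTop ℚ) := by
  have h0 : ν (xElt k) = ((1 : ℚ) : WithTop ℚ) := h.value 0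
  rw [AddValuation.map_pow, h0, ← WithTop.coe_nsmul, nsmul_one]

variable [Fact p.Prime]

theorem IsNuStar.pos_paramVR (h : IsNuStar p k ν) (n : ℕ) :
    0 < ν (paramVR p (xElt k) (yElt k) n) := by
  have hp : p ≠ 0 := (Fact.out : p.Prime).ne_zero
  match n with
  | 0 =>
    change 0 < ν (xElt k)
    rw [← pow_one (xElt k), h.xElt_pow]
    exact WithTop.coe_lt_coe.2 (by simp)
  | 1 =>
    change 0 < ν (genSeq p (xElt k) (yElt k) 1)
    rw [h.value]
    exact WithTop.coe_lt_coe.2 (by rw [betaBar]; positivity)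
  | 2 =>
    have h2 := h.value 2
    have h1 := h.xElt_pow 1
    rw [pow_one] at h1
    rw [genSeq_two_eq] at h2
    refine AddValuation.pos_of_lt h2 h1 ?_
    rw [betaBar_add_two hp 0, betaBar, mul_one_div_cancel (by positivity), Nat.cast_one]
    exact lt_add_of_pos_right _ (by positivity)
  | n + 3 =>
    have h3 := h.value (n + 3)
    rw [genSeq_add_three_eq] at h3
    have h1 : ν (xElt k ^ p ^ (2 * n + 2) * genSeq p (xElt k) (yElt k) (n + 1)) =
        (((p ^ (2 * n + 2) : ℕ) + betaBar p (n + 1) : ℚ) : WithTop ℚ) := by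
      rw [AddValuation.map_mul, h.xElt_pow, h.value, WithTop.coe_add]
    refine AddValuation.pos_of_lt h3 h1 ?_
    rw [betaBar_add_three hp]
    push_cast
    rw [add_assoc]
    exact lt_add_of_pos_left _ (by positivity)

theorem IsNuStar.chainRing_le (h : IsNuStar p k ν) (n : ℕ) :
    chainRing k (paramVR p (xElt k) (yElt k)) n ≤ ν.localSubring := by
  refine origin_le (fun a => ?_) (AddValuation.memMax_localSubring.2 (h.pos_paramVR n))
    (AddValuation.memMax_localSubring.2 (h.pos_paramVR (n + 1)))
  rw [AddValuation.mem_localSubring]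
  by_cases ha : a = 0
  · simp [ha]
  · exact (h.trivial_on a ha).ge

variable [CharP k p]

theorem IsNuStar.isSequenceA (h : IsNuStar p k ν) (hc : 0 < c) :
    IsSequenceA p c k ν (fun j => chainRing k (paramVA p (xElt k) (vElt p c k)) (j - 1)) :=
  isTransformSequence_chainRing (isParameterChain_A p c k)
    (fun n => (chainRing_A_le_Q p c k hc n).trans (h.chainRing_le n)) rfl rfl (fun _ => rfl)

theorem IsNuStar.isSequenceR (h : IsNuStar p k ν) (hc : 0 < c) :
    IsSequenceR p c k ν (fun j => chainRing k (paramVR p (uElt p k) (vElt p c k)) (j - 1)) :=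
  isTransformSequence_chainRing (isParameterChain_R p c k)
    (fun n => (chainRing_R_le_A p c k n).trans
      ((chainRing_A_le_Q p c k hc n).trans (h.chainRing_le n))) rfl rfl (fun _ => rfl)

end Transforms

/-! ### Stable forms -/

section StableForms

open LocalSubring

variable {L : Type*} [Field L] {k : Type*} [Field k] [Algebra k L] {e f : ℕ → ℕ} {t s : ℕ → L}
  {n p α β : ℕ} [Fact p.Prime]

/-- If a quadratic transform of the smaller ring were contained in the larger one, the maximal
ideal of the smaller ring would generate a principal ideal there. But that ideal is primary to the
maximal ideal of a two-dimensional ring. -/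
theorem IsPowerForm.not_le_of_isQuadraticTransform [CharP L p]
    (hF : IsPowerForm k t s n (p ^ α) (p ^ β)) (ht : IsParameterChain k e t)
    (hs : IsParameterChain k f s) {B : LocalSubring L}
    (hB : IsQuadraticTransform (chainRing k s n) B) :
    ¬ B.toSubring ≤ (chainRing k t n).toSubring := by
  intro hle
  have hp := (Fact.out : p.Prime).pos
  obtain ⟨w, hw, hw0, hdiv⟩ := hB.exists_dvd
  have hRA := hF.chainRing_le ht (pow_pos hp _).ne' (pow_pos hp _).ne'
  have hu := hF.memMax_left ht (pow_pos hp _).ne'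
  have hv := hF.memMax_right ht (pow_pos hp _).ne'
  obtain ⟨hreg, hdim, -⟩ := isRegularParameters_origin (ht.indep n)
  have hnoeth := (origin_structure (ht.indep n)).1
  let I : Ideal (chainRing k t n).toSubring := Ideal.span {⟨s n, hu.1⟩, ⟨s (n + 1), hv.1⟩}
  have hrad : maximalIdeal (chainRing k t n).toSubring ≤ I.radical := by
    intro z hz
    obtain ⟨x, hx, y, hy, h⟩ := hF.exists_pow_eq ht (memMax_coe.2 hz)
    refine ⟨p ^ (β + α), Ideal.mem_span_pair.2 ⟨⟨x, hx⟩, ⟨y, hy⟩, Subtype.ext ?_⟩⟩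
    change x * s n + y * s (n + 1) = (z : L) ^ p ^ (β + α)
    rw [h]
    ring
  obtain ⟨m, hm⟩ := Ideal.exists_pow_le_of_le_radical_of_fg hrad
    ((isNoetherianRing_iff_ideal_fg _).1 hnoeth _)
  refine false_of_forall_div_mem hreg hdim (hw.of_le hRA) hw0 hm ?_
  intro z hz
  obtain ⟨x, y, h⟩ := Ideal.mem_span_pair.1 hz
  have h' : (z : L) / w = x * (s n / w) + y * (s (n + 1) / w) := by
    rw [← h]
    change ((x : L) * s n + y * s (n + 1)) / w = _
    ring
  rw [h']
  exact add_mem (mul_mem x.2 (hle (hdiv _ (hs.memMax_left n))))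
    (mul_mem y.2 (hle (hdiv _ (hs.memMax_right n))))

theorem LocalSubring.MemMax.le_of_mul_pow_eq {B : LocalSubring L} {x σ γ : L} {i j : ℕ}
    (hx : B.MemMax x) (hx0 : x ≠ 0) (hγ : ¬ B.MemMax γ) (hσ : σ ∈ B.toSubring)
    (h : γ * x ^ i = σ * x ^ j) : j ≤ i := by
  by_contra! hij
  obtain ⟨d, rfl⟩ := Nat.exists_eq_add_of_lt hij
  refine hγ ?_
  have h1 : γ = σ * x ^ (d + 1) := mul_right_cancel₀ (pow_ne_zero i hx0) (by rw [h]; ring)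
  rw [h1]
  exact (hx.pow d.succ_ne_zero).mul_left hσ

/-- A power form is a stable form. Conversely, in any stable form for the same parameters the
exponent of `t n` in `s (n + 1)` vanishes, since `s (n + 1)` is not divisible by `t n`, and so the
two exponents are determined by `s n` and by the class of `s (n + 1)` modulo `t n`. -/
theorem IsPowerForm.isStableForm_iff (hF : IsPowerForm k t s n (p ^ α) (p ^ β))
    (ht : IsParameterChain k e t) {α' β' : ℕ} :
    IsStableForm p 1 (chainRing k t n) (s n) (s (n + 1)) (t n) α' β' ↔ α' = α ∧ β' = β := by
  have hp := (Fact.out : p.Prime)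
  obtain ⟨σ, lam, Λ, hσ, hlam, hΛ, e1, e2⟩ := hF
  let A := chainRing k t n
  let a : A.toSubring := ⟨t n, left_mem_origin k _ _⟩
  let b : A.toSubring := ⟨t (n + 1), right_mem_origin k _ _⟩
  let lam' : A.toSubring := ⟨lam, hlam.mem_of_sub_one⟩
  let sn : A.toSubring := lam' * b ^ p ^ β + a * ⟨Λ, hΛ⟩
  obtain ⟨hnoeth, hm, hprime, hndvd⟩ : IsNoetherianRing A.toSubring ∧
      maximalIdeal A.toSubring = Ideal.span {a, b} ∧ (Ideal.span {a}).IsPrime ∧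
      b ∉ Ideal.span {a} := origin_structure (ht.indep n)
  have hsn : (sn : L) = s (n + 1) := e2.symm
  have hlam' : IsUnit lam' := isUnit_iff_not_memMax.2 hlam.not_memMax_of_sub_one
  have haM : A.MemMax (t n) := ht.memMax_left n
  have ha0 := ht.ne_zero n
  -- the order of the class of `s (n + 1)`
  have h0 : Ideal.Quotient.mk (Ideal.span {a}) a = 0 :=
    Ideal.Quotient.eq_zero_iff_mem.2 (Ideal.mem_span_singleton_self _)
  have hord : ∀ (_ : IsDomain (A.toSubring ⧸ Ideal.span {a}))
      (_ : IsDiscreteValuationRing (A.toSubring ⧸ Ideal.span {a})),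
      IsDiscreteValuationRing.addVal (A.toSubring ⧸ Ideal.span {a})
        (Ideal.Quotient.mk (Ideal.span {a}) sn) = ((p ^ β : ℕ) : ℕ∞) := by
    intro _ _
    obtain ⟨-, -, hirr⟩ :=
      isDiscreteValuationRing_quotient_of_maximalIdeal_eq_span_pair hm hprime hndvd
    have h1 := IsDiscreteValuationRing.addVal_uniformizer hirr
    have h2 := IsDiscreteValuationRing.addVal_eq_zero_of_unit
      (hlam'.map (Ideal.Quotient.mk (Ideal.span {a}))).unit
    rw [IsUnit.unit_spec] at h2
    rw [map_add, map_mul, map_mul, h0, zero_mul, add_zero, map_pow,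
      IsDiscreteValuationRing.addVal_mul, IsDiscreteValuationRing.addVal_pow,
      h1, nsmul_one, h2, zero_add]
  constructor
  · rintro ⟨γ, f, x', m, hx', hγ, h1, h2, hd, hdvr, h3⟩
    obtain rfl : x' = a := Subtype.ext hx'
    constructor
    · have h4 : (γ : L) * t n ^ (1 * p ^ α') = σ * t n ^ p ^ α := h1.symm.trans e1
      rw [one_mul] at h4
      have hγ' := isUnit_iff_not_memMax.1 hγ
      exact Nat.pow_right_injective hp.two_le (le_antisymm
        (haM.le_of_mul_pow_eq ha0 hσ.not_memMax_of_sub_one γ.2 h4.symm)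
        (haM.le_of_mul_pow_eq ha0 hγ' hσ.mem_of_sub_one h4))
    · have h4 : sn = a ^ m * f := Subtype.ext (hsn.trans h2)
      have h5 := hord hd hdvr
      rcases Nat.eq_zero_or_pos m with rfl | hm0
      · rw [h4, pow_zero, one_mul, h3, Nat.cast_inj] at h5
        exact Nat.pow_right_injective hp.two_le h5
      · rw [h4, map_mul, map_pow, h0, zero_pow hm0.ne', zero_mul,
          IsDiscreteValuationRing.addVal_zero] at h5
        exact absurd h5 (ENat.top_ne_natCast _)
  · rintro ⟨rfl, rfl⟩
    obtain ⟨hd, hdvr, -⟩ :=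
      isDiscreteValuationRing_quotient_of_maximalIdeal_eq_span_pair hm hprime hndvd
    refine ⟨⟨σ, hσ.mem_of_sub_one⟩, sn, a, 0, rfl,
      isUnit_iff_not_memMax.2 hσ.not_memMax_of_sub_one, ?_, ?_, hd, hdvr, hord hd hdvr⟩
    · rw [one_mul]; exact e1
    · rw [pow_zero, one_mul, hsn]

end StableForms

theorem mainTheorem11 (p : ℕ) [Fact p.Prime] (k : Type*) [Field k] [IsAlgClosed k] [CharP k p]
    (c : ℕ) (hc : 0 < c) (hpc : p - 1 ∣ c) :
    -- the valuation exists
    (∃ ν : AddValuation (FunctionField₂ k) (WithTop ℚ), IsNuStar p k ν) ∧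
    ∀ ν : AddValuation (FunctionField₂ k) (WithTop ℚ), IsNuStar p k ν →
      -- the sequences of local rings exist
      (∃ A, IsSequenceA p c k ν A) ∧ (∃ R, IsSequenceR p c k ν R) ∧
      ∀ A R : ℕ → LocalSubring (FunctionField₂ k),
        IsSequenceA p c k ν A → IsSequenceR p c k ν R →
        -- finiteness and domination, and no quadratic transform of `R j` factors through `A j`
        (∀ j, 1 ≤ j →
          (∃ h : (R j).toSubring ≤ (A j).toSubring, (Subring.inclusion h).Finite) ∧
          R j ≤ A j ∧
          ∀ R', IsQuadraticTransform (R j) R' → ¬ R'.toSubring ≤ (A j).toSubring) ∧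
        -- the expressions in `A (j + 1)`
        (∀ j, 1 ≤ j → ∃ σ lam Λ : (A (j + 1)).toSubring, IsUnit σ ∧ IsUnit lam ∧
          (Odd j →
            paramUR p (uElt p k) (vElt p c k) (j + 1) =
              (σ : FunctionField₂ k) * paramXA p (xElt k) (vElt p c k) (j + 1) ∧
            paramVR p (uElt p k) (vElt p c k) (j + 1) =
              (lam : FunctionField₂ k) * paramVA p (xElt k) (vElt p c k) (j + 1) ^ p +
                paramXA p (xElt k) (vElt p c k) (j + 1) * (Λ : FunctionField₂ k)) ∧
          (Even j →
            paramUR p (uElt p k) (vElt p c k) (j + 1) =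
              (σ : FunctionField₂ k) * paramXA p (xElt k) (vElt p c k) (j + 1) ^ p ∧
            paramVR p (uElt p k) (vElt p c k) (j + 1) =
              (lam : FunctionField₂ k) * paramVA p (xElt k) (vElt p c k) (j + 1) +
                paramXA p (xElt k) (vElt p c k) (j + 1) * (Λ : FunctionField₂ k))) ∧
        -- the invariants of the stable forms, with `a = 1`
        (∀ j, 1 ≤ j → ∀ α β : ℕ,
          IsStableForm p 1 (A j) (paramUR p (uElt p k) (vElt p c k) j)
              (paramVR p (uElt p k) (vElt p c k) j) (paramXA p (xElt k) (vElt p c k) j) α β ↔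
            α = (if Odd j then 1 else 0) ∧ β = (if Odd j then 0 else 1)) := by
  refine ⟨exists_isNuStar p k, fun ν hν => ⟨⟨_, hν.isSequenceA hc⟩, ⟨_, hν.isSequenceR hc⟩, ?_⟩⟩
  intro A R hA hR
  have := charP_functionField₂ p k
  have hAj : ∀ n, A (n + 1) = chainRing k (paramVA p (xElt k) (vElt p c k)) n := fun n =>
    hA.unique (hν.isSequenceA hc) (Nat.le_add_left 1 n)
  have hRj : ∀ n, R (n + 1) = chainRing k (paramVR p (uElt p k) (vElt p c k)) n := fun n =>
    hR.unique (hν.isSequenceR hc) (Nat.le_add_left 1 n)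
  refine ⟨fun j hj => ?_, fun j hj => ?_, fun j hj α β => ?_⟩
  · obtain ⟨n, rfl⟩ := Nat.exists_eq_add_of_le' hj
    rw [hAj, hRj]
    exact ⟨⟨_, (isFiniteOver_R_A p c k n).finite⟩, chainRing_R_le_A p c k n, fun R' hR' =>
      (isPowerForm_A_R p c k n).not_le_of_isQuadraticTransform (isParameterChain_A p c k)
        (isParameterChain_R p c k) hR'⟩
  · rw [hAj]
    obtain ⟨σ, lam, Λ, hσ, hlam, hΛ, e1, e2⟩ := isPowerForm_A_R p c k j
    refine ⟨⟨σ, hσ.mem_of_sub_one⟩, ⟨lam, hlam.mem_of_sub_one⟩, ⟨Λ, hΛ⟩,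
      LocalSubring.isUnit_iff_not_memMax.2 hσ.not_memMax_of_sub_one,
      LocalSubring.isUnit_iff_not_memMax.2 hlam.not_memMax_of_sub_one, fun hj' => ?_, fun hj' => ?_⟩
    · simp only [Nat.odd_iff.1 hj', Nat.even_iff.1 hj'.add_one, pow_zero, pow_one] at e1 e2
      exact ⟨e1, e2⟩
    · simp only [Nat.even_iff.1 hj', Nat.odd_iff.1 hj'.add_one, pow_zero, pow_one] at e1 e2
      exact ⟨e1, e2⟩
  · obtain ⟨n, rfl⟩ := Nat.exists_eq_add_of_le' hj
    rw [hAj]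
    refine ((isPowerForm_A_R p c k n).isStableForm_iff (isParameterChain_A p c k)).trans ?_
    rcases Nat.even_or_odd n with h | h
    · rw [if_pos h.add_one, if_pos h.add_one, Nat.even_iff.1 h, Nat.odd_iff.1 h.add_one]
    · rw [if_neg (Nat.not_odd_iff_even.2 h.add_one), if_neg (Nat.not_odd_iff_even.2 h.add_one),
        Nat.odd_iff.1 h, Nat.even_iff.1 h.add_one]
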